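/- **Model.** There are $n$ validators; time proceeds in rounds $0,1,2,\dots$, and slot $t$ consists of the $4\Delta$ rounds starting at $4\Delta t$ ($\Delta\ge 1$). Put $\mathrm{vote}(t)=4\Delta t+\Delta$, $\mathrm{fc}(t)=4\Delta t+2\Delta$, $\mathrm{merge}(t)=4\Delta t+3\Delta$. An adaptive adversary corrupts a growing set $A_r$ of validators, $f=|\bigcup_r A_r|<n/3$, and decides which honest validators are awake; asleep validators do nothing and their messages are queued. A validator awake since round $0$ is active; one that wakes in a round of $(\mathrm{vote}(s-1)+\Delta,\mathrm{vote}(s)+\Delta]$ executes the protocol silently and becomes active at $\mathrm{vote}(s+1)$. $H_r$ is the set of (honest, awake) active validators at round $r$. The network is synchronous ($\mathrm{GST}=0$): messages are unforgeable, are received after they are sent, reach awake honest validators within $\Delta$ rounds if sent by an honest validator, and votes received by an awake honest validator (also inside proposals) are relayed at once. An execution is *compliant* if moreover $|H_{\mathrm{vote}(t-1)}\setminus A_{\mathrm{vote}(t)}|>|A_{\mathrm{vote}(t)}|$ for all $t\ge 1$. The view $V_i$ is the set of messages received so far by $v_i$. Each slot $t$ has one proposer. A chain $C$ has height $C.p$,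 the slot of its tip ($-1$ for genesis); $\preceq$ is the prefix order, and $\max$ refers to height. The parameter $\kappa>1$ is an integer, and $C^{\lceil\kappa}$ at slot $t$ is the longest prefix of $C$ of height at most $t-\kappa$ (genesis if there is none). **Fork choice.** $V^{C,t}$ is the set of votes in $V$ for chains $\succeq C$ that remain after removing all votes of validators that equivocate in $V$ (two votes in one slot for different chains), then votes of slots $<t-1$, then all but the latest votes of each validator (finality components are ignored). $\mathsf S(V,t)$ is the set of validators with a vote of slot $\ge t-1$ in $V$. $\mathrm{MFC}(V,V',B,t)$ is the longest $C\succeq B$ with $C=B$ or $|V^{C,t}\cap V'^{C,t}|>|\mathsf S(V',t)|/2$. $\mathrm{fcs}(V,t)$ is $(C,Q)$, where $C$ is the highest chain such that at least $2n/3$ validators have a slot-$t$ vote in $V$ for a chain $\succeq C$, and $Q$ is the set of these votes; it is $(\text{genesis},\emptyset)$ if there is no such chain. **Protocol 1** (output $\mathsf{Ch}_i$, state $V_i^{fr},C_i^{fr}$, initially genesis/empty). *Round $4\Delta t$*: an active proposer $v_i$ computes $(C^C,Q^C)=\mathrm{fcs}(V_i,t-1)$ and sends $[\text{propose},C_p,C^C,Q^C,t]$,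 where $C_p$ is an extension of $\mathrm{MFC}(V_i,V_i,C^C,t)$ of height $t$ that contains all pending transactions (unspecified if the fork choice already has height $\ge t$). *On receiving, in a round of $[4\Delta t,4\Delta t+\Delta]$,* a valid slot-$t$ proposal (from the proposer, $C_p.p=t$, and $Q^C$ a certificate for $C^C$ of at least $2n/3$ validators' slot-$(t-1)$ votes, or $C^C$ genesis and $Q^C=\emptyset$) with $C_i^{fr}\preceq C^C$: $C_i^{fr}\leftarrow C^C$. *Round $\mathrm{vote}(t)$*: $M=\mathrm{MFC}(V_i^{fr},V_i,C_i^{fr},t)$; $\mathsf{Ch}_i\leftarrow\max\{C\in\{\mathsf{Ch}_i,M^{\lceil\kappa}\}:C\preceq M\}$; if active, vote for a chain of height $t$ proposed in slot $t$ by its proposer that extends $M$ if there is one, otherwise for $M$. *Round $\mathrm{fc}(t)$*: $(C,Q)=\mathrm{fcs}(V_i,t)$; if $Q\ne\emptyset$ then $\mathsf{Ch}_i\leftarrow C$. *Round $\mathrm{merge}(t)$*: $V_i^{fr}\leftarrow V_i$ and $C_i^{fr}\leftarrow$ the chain of $\mathrm{fcs}(V_i,t)$. **Protocol 2** (full protocol,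 output $\mathsf{chAva}_i$, in addition to a finalized chain). Checkpoints are pairs $(C,c)$, ordered by $c$ with equality only for identical ones; $(\text{genesis},0)$ is justified in $V$, and $(C,c)$ is justified in $V$ if for some justified $(C',c')$ with $C'\preceq C$, $c'<c$, at least $2n/3$ validators have a vote in $V$ that carries the finality vote $(C',c')\to(C,c)$. $\mathsf{GJ}(V)$ is the greatest justified checkpoint. $\mathrm{fcs}$ is replaced by $\mathrm{fc}(V,t)$, which is $\mathrm{fcs}(V,t)$ if its chain extends that of $\mathsf{GJ}(V)$ and $(\mathsf{GJ}(V).\text{chain},\emptyset)$ otherwise. Proposals also carry $\mathsf{GJ}_p=\mathsf{GJ}(V_p)$ (and $Q^C=\emptyset$ is valid for $C^C=\mathsf{GJ}_p.\text{chain}$). Validators also keep $\mathsf{GJ}^{fr}_i$, set to $\mathsf{GJ}(V_i)$ at $\mathrm{merge}(t)$. At $\mathrm{vote}(t)$, each valid slot-$t$ proposal received in $[4\Delta t,4\Delta t+\Delta]$ with $\mathsf{GJ}_p$ justified in $V_i$ and $\mathsf{GJ}_p\ge\mathsf{GJ}^{fr}_i$ is processed: $\mathsf{GJ}^{fr}_i\leftarrow\mathsf{GJ}_p$;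 if $C^{fr}_i\not\succeq\mathsf{GJ}_p.\text{chain}$ then $C^{fr}_i\leftarrow\mathsf{GJ}_p.\text{chain}$; if then $C_i^{fr}\preceq C^C$, $C_i^{fr}\leftarrow C^C$. After that, $\mathsf{chAva}_i\leftarrow\max\{C\in\{\mathsf{chAva}_i,M^{\lceil\kappa},\mathsf{GJ}^{fr}_i.\text{chain}\}:C\preceq M\}$, and the vote carries the finality vote from $\mathsf{GJ}^{fr}_i$ to $(\mathsf{chAva}_i,t)$ if $\mathsf{GJ}^{fr}_i.c=t-1$ and to $(\mathsf{GJ}^{fr}_i.\text{chain},t)$ otherwise. At $\mathrm{fc}(t)$, with $C$ the chain of $\mathrm{fc}(V_i,t)$: if $\mathsf{chAva}_i\not\succeq C$ then $\mathsf{chAva}_i\leftarrow C$. **Lemma (liveness of fast confirmations).** Say that fast confirmation is live in slot $t$ if the following holds: if $|H_{\mathrm{vote}(t)}|\ge\frac23n$ and a validator that is not corrupted before round $\mathrm{vote}(t)$ proposes a chain $C_p$ in slot $t$, then for every $v_i\in H_{\mathrm{fc}(t)}$ the output chain of $v_i$ after round $\mathrm{fc}(t)$ extends $C_p$. Call slot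 $g$ honestly led if its proposer is active at round $4\Delta g$ and not corrupted before round $\mathrm{vote}(g)$. 1. In every compliant execution of Protocol 1, fast confirmation is live in every slot, for the output $\mathsf{Ch}$. 2. In every compliant execution of Protocol 2, fast confirmation is live, for the output $\mathsf{chAva}$, in every slot $t$ such that each window of $\kappa$ consecutive slots before $t$ contains an honestly led slot. 3. Consequently the same holds with overwhelming probability for Protocol 2. Consider random compliant executions of Protocol 2 in which the proposer of each slot is uniform given everything decided before its election, and suppose that for each slot $t$ there is a set of at least $h_0$ validators, determined before the election for slot $t$, that are active at round $4\Delta t$ and not corrupted before round $\mathrm{vote}(t)$. Then, except with probability at most $T(1-h_0/n)^\kappa$, fast confirmation is live in all slots $t\le T$, for the output $\mathsf{chAva}$. -/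

import Mathlib

/-! Blocks and chains. A chain is identified with the list of its non-genesis blocks, from the
child of the genesis block to the tip; the genesis block (slot `-1`, no transactions) is implicit. -/

structure Block (Tx : Type*) where
  body : Finset Tx
  slot : ℕ

structure Chain (Tx : Type*) where
  blocks : List (Block Tx)
  increasing : blocks.Pairwise (fun a b => a.slot < b.slot)

namespace Chain

variable {Tx : Type*}

def genesis : Chain Tx := ⟨[], List.Pairwise.nil⟩

/-- The slot of the tip (the height, or length, of the chain). -/
def p (C : Chain Tx) : ℤ :=
  match C.blocks.getLast? with
  | none => -1
  | some b => (b.slot : ℤ)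

/-- `C.Prefix D`: the chain `D` extends (or equals) the chain `C`. -/
def Prefix (C D : Chain Tx) : Prop := C.blocks <+: D.blocks

def Contains (C : Chain Tx) (tx : Tx) : Prop := ∃ b ∈ C.blocks, tx ∈ b.body

open Classical in
/-- A chain of maximal height in `S`; the genesis chain if there is none. -/
noncomputable def longest (S : Set (Chain Tx)) : Chain Tx :=
  if h : ∃ C ∈ S, ∀ D ∈ S, D.p ≤ C.p then h.choose else genesis

end Chain

infix:50 " ⪯ " => Chain.Prefix

/-- The longest prefix of `C` of height at most `t - κ` (the genesis chain if there is none). -/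
noncomputable def kDeep {Tx : Type*} (κ : ℕ) (C : Chain Tx) (t : ℕ) : Chain Tx :=
  Chain.longest {D | D ⪯ C ∧ D.p ≤ (t : ℤ) - κ}

/-! Messages. `F` is the type of the finality component of a vote and `G` the type of the
finality component of a proposal (both are `Unit` in the protocol without finality). -/

structure Vote (n : ℕ) (Tx F : Type*) where
  chain : Chain Tx
  fin : F
  slot : ℕ
  sender : Fin n

/-- A proposal: the proposed chain, the fast-confirmed chain `certChain` with its certificate
`cert`, the finality component, the slot, and the sender. -/
structure Proposal (n : ℕ) (Tx F G : Type*) where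
  chain : Chain Tx
  certChain : Chain Tx
  cert : Set (Vote n Tx F)
  gj : G
  slot : ℕ
  sender : Fin n

inductive Message (n : ℕ) (Tx F G : Type*) where
  | vote (m : Vote n Tx F) : Message n Tx F G
  | propose (m : Proposal n Tx F G) : Message n Tx F G

abbrev View (n : ℕ) (Tx F G : Type*) := Set (Message n Tx F G)

section ForkChoice

variable {n : ℕ} {Tx F G : Type*}

def votesIn (V : View n Tx F G) : Set (Vote n Tx F) := {m | Message.vote m ∈ V}

/-- A validator equivocates in `W` if `W` has two votes of it for different chains in one slot. -/
def EquivocatesIn (W : Set (Vote n Tx F)) (k : Fin n) : Prop :=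
  ∃ a ∈ W, ∃ b ∈ W, a.sender = k ∧ b.sender = k ∧ a.slot = b.slot ∧ a.chain ≠ b.chain

def filEq (W : Set (Vote n Tx F)) : Set (Vote n Tx F) := {m ∈ W | ¬ EquivocatesIn W m.sender}

def filExp (W : Set (Vote n Tx F)) (t : ℤ) : Set (Vote n Tx F) := {m ∈ W | t - 1 ≤ (m.slot : ℤ)}

def filLmd (W : Set (Vote n Tx F)) : Set (Vote n Tx F) :=
  {m ∈ W | ∀ m' ∈ W, m'.sender = m.sender → m'.slot ≤ m.slot}

/-- The latest, non-expired, non-equivocating votes for chains that extend `C`. The finality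
component of a vote plays no role in the fork choice and is dropped. -/
def support (V : View n Tx F G) (C : Chain Tx) (t : ℤ) : Set (Chain Tx × ℕ × Fin n) :=
  {x | ∃ m ∈ filLmd (filExp (filEq (votesIn V)) t), C ⪯ m.chain ∧ x = (m.chain, m.slot, m.sender)}

/-- The validators with a non-expired vote in `V`. -/
def voters (V : View n Tx F G) (t : ℤ) : Set (Fin n) :=
  {k | ∃ m ∈ filExp (votesIn V) t, m.sender = k}

/-- The majority fork-choice function. -/
noncomputable def mfc (V V' : View n Tx F G) (base : Chain Tx) (t : ℤ) : Chain Tx :=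
  Chain.longest {C | base ⪯ C ∧
    (C = base ∨ (voters V' t).ncard < 2 * (support V C t ∩ support V' C t).ncard)}

/-- The chains supported by the slot-`t` votes of at least `2n/3` validators. -/
def fastCands (V : View n Tx F G) (t : ℤ) : Set (Chain Tx) :=
  {C | 2 * n ≤ 3 * {j | ∃ m ∈ votesIn V, (m.slot : ℤ) = t ∧ C ⪯ m.chain ∧ m.sender = j}.ncard}

open Classical in
noncomputable def fastConfirmSimple (V : View n Tx F G) (t : ℤ) :
    Chain Tx × Set (Vote n Tx F) :=
  if (fastCands V t).Nonempty then
    (Chain.longest (fastCands V t),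
      {m ∈ votesIn V | (m.slot : ℤ) = t ∧ Chain.longest (fastCands V t) ⪯ m.chain})
  else (Chain.genesis, ∅)

/-- `Q` certifies `C` in slot `t`: it consists of slot-`t` votes for chains extending `C`, from at
least `2n/3` validators. -/
def Certifies (Q : Set (Vote n Tx F)) (C : Chain Tx) (t : ℤ) : Prop :=
  (∀ m ∈ Q, (m.slot : ℤ) = t ∧ C ⪯ m.chain) ∧ 2 * n ≤ 3 * {j | ∃ m ∈ Q, m.sender = j}.ncard

end ForkChoice

/-! Time. A slot has `4Δ` rounds. -/

def proposing (Δ t : ℕ) : ℕ := 4 * Δ * t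
def voting (Δ t : ℕ) : ℕ := 4 * Δ * t + Δ
def fastConfirming (Δ t : ℕ) : ℕ := 4 * Δ * t + 2 * Δ
def merging (Δ t : ℕ) : ℕ := 4 * Δ * t + 3 * Δ

/-- What happens in a run with `n` validators and delay bound `Δ`: the adversarial validators, the
awake validators and the transaction pool in each round, the proposer of each slot, the messages
that a validator receives in a round (in the order of receipt), and those that an honest validator
sends in a round. -/
structure Run (n Δ : ℕ) (Tx F G : Type*) where
  corrupt : ℕ → Set (Fin n)
  awake : ℕ → Set (Fin n)
  txpool : ℕ → Finset Tx
  proposer : ℕ → Fin n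
  inbox : Fin n → ℕ → List (Message n Tx F G)
  sent : Fin n → ℕ → Set (Message n Tx F G)

namespace Run

variable {n Δ : ℕ} {Tx F G : Type*} (e : Run n Δ Tx F G)

/-- The messages received in round `r`, directly or, for votes, inside a proposal. -/
def received (i : Fin n) (r : ℕ) : View n Tx F G :=
  {m | m ∈ e.inbox i r ∨
    ∃ P : Proposal n Tx F G, Message.propose P ∈ e.inbox i r ∧ ∃ w ∈ P.cert, m = Message.vote w}

/-- The view of validator `i` at round `r`. -/
def view (i : Fin n) (r : ℕ) : View n Tx F G := {m | ∃ r' ≤ r, m ∈ e.received i r'}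

/-- The active validators at round `r`: honest, awake, and through with the joining protocol, where
a validator that wakes in a round of `(voting (s - 1) + Δ, voting s + Δ]` becomes active at
`voting (s + 1)`. Validators that have been awake from the start are active from the start. -/
def active (r : ℕ) : Set (Fin n) :=
  {i | i ∉ e.corrupt r ∧
    ((∀ r' ≤ r, i ∈ e.awake r') ∨
      ∃ s, voting Δ (s + 1) ≤ r ∧ ∀ r', voting Δ s + Δ ≤ r' → r' ≤ r → i ∈ e.awake r')}

/-- `f`, the number of validators that are ever corrupted. -/
noncomputable def f : ℕ := (⋃ r, e.corrupt r).ncard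

/-- The synchronous network (`GST = 0`), with best-effort gossip and unforgeable messages. -/
structure Synchronous : Prop where
  corrupt_mono : Monotone e.corrupt
  txpool_mono : Monotone e.txpool
  asleep : ∀ i r, i ∉ e.corrupt r → i ∉ e.awake r → e.inbox i r = []
  /-- A message is received after it was sent; a message of a validator that is still honest was
  sent by this validator. -/
  vote_authentic : ∀ i r, i ∉ e.corrupt r → ∀ m : Vote n Tx F, Message.vote m ∈ e.view i r →
    ∃ r' < r, m.sender ∈ e.corrupt r' ∨ Message.vote m ∈ e.sent m.sender r'
  proposal_authentic : ∀ i r, i ∉ e.corrupt r → ∀ P : Proposal n Tx F G,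
    Message.propose P ∈ e.view i r →
    ∃ r' < r, P.sender ∈ e.corrupt r' ∨ Message.propose P ∈ e.sent P.sender r'
  /-- Messages sent by honest validators arrive within `Δ` rounds, or upon waking up. -/
  delivery : ∀ j r', j ∉ e.corrupt r' → ∀ m ∈ e.sent j r',
    ∀ i r, r' + Δ ≤ r → i ∉ e.corrupt r → i ∈ e.awake r → m ∈ e.view i r
  /-- Honest validators relay every vote that they receive. -/
  relay_vote : ∀ j r', j ∉ e.corrupt r' → ∀ m : Vote n Tx F, Message.vote m ∈ e.received j r' →
    ∀ i r, r' + Δ ≤ r → i ∉ e.corrupt r → i ∈ e.awake r → Message.vote m ∈ e.view i r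
  /-- Honest validators relay every slot-`t` proposal received in the first `Δ` rounds of `t`. -/
  relay_proposal : ∀ j r', j ∉ e.corrupt r' → ∀ P : Proposal n Tx F G,
    Message.propose P ∈ e.received j r' →
    proposing Δ P.slot ≤ r' → r' < proposing Δ P.slot + Δ →
    ∀ i r, r' + Δ ≤ r → i ∉ e.corrupt r → i ∈ e.awake r → Message.propose P ∈ e.view i r

/-- A compliant run of the synchronous sleepy model with `f < n/3`. -/
structure Compliant : Prop where
  synchronous : e.Synchronous
  f_lt : 3 * e.f < n
  /-- The sleepiness condition for slot `t + 1`. -/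
  sleepiness : ∀ t, (e.corrupt (voting Δ (t + 1))).ncard <
    (e.active (voting Δ t) \ e.corrupt (voting Δ (t + 1))).ncard

/-- `C'` is a possible value of `Extend(C, t)`; the value is unspecified if `t ≤ C.p`. -/
def IsExtend (C : Chain Tx) (t : ℕ) (C' : Chain Tx) : Prop :=
  C.p < t → C ⪯ C' ∧ C'.p = t ∧ ∀ tx ∈ e.txpool (proposing Δ t), C'.Contains tx

/-- `C` is a chain proposed in slot `t` by the slot's proposer, of height `t`, extending `base`,
according to the view of `i` at round `r`. -/
def IsProposed (i : Fin n) (r t : ℕ) (base C : Chain Tx) : Prop :=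
  ∃ P : Proposal n Tx F G, Message.propose P ∈ e.view i r ∧ P.slot = t ∧
    P.sender = e.proposer t ∧ P.chain = C ∧ base ⪯ C ∧ C.p = t

/-- `C` is a possible choice of the chain to vote for, given the fork-choice output `base`. -/
def IsVoteChoice (i : Fin n) (r t : ℕ) (base C : Chain Tx) : Prop :=
  e.IsProposed i r t base C ∨ ((¬ ∃ D, e.IsProposed i r t base D) ∧ C = base)

/-- Honest validators send nothing but the proposal of an active proposer at the propose round and
the votes of active validators at the vote round. -/
def SendsNothingElse : Prop :=
  ∀ i r, i ∉ e.corrupt r →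
    (¬ ∃ t, (r = proposing Δ t ∧ i = e.proposer t ∧ i ∈ e.active r) ∨
      (r = voting Δ t ∧ i ∈ e.active r)) → e.sent i r = ∅

/-- The local state of validator `i` before round `r`, when `step` is executed in each round in
which `i` is honest and awake. -/
noncomputable def stateBefore {S : Type*} (init : S) (step : Fin n → ℕ → S → S) (i : Fin n) :
    ℕ → S
  | 0 => init
  | r + 1 =>
    open Classical in
    if i ∉ e.corrupt r ∧ i ∈ e.awake r then step i r (stateBefore init step i r)
    else stateBefore init step i r

/-- The slot `t` has a proposer that is active at the propose round (so that it sends a proposal)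
and honest up to the vote round. -/
def HonestlyLed (t : ℕ) : Prop :=
  e.proposer t ∈ e.active (proposing Δ t) ∧ ∀ r < voting Δ t, e.proposer t ∉ e.corrupt r

/-- Liveness of fast confirmations in slot `t` for the output chains `out i r`: if at least `2n/3`
validators are active at the vote round and a validator that is honest up to the vote round
proposes a chain, then the output of each validator active at the fast-confirmation round, after
that round, extends the proposed chain. -/
def FastLive (out : Fin n → ℕ → Chain Tx) (t : ℕ) : Prop :=
  2 * n ≤ 3 * (e.active (voting Δ t)).ncard →
  ∀ (v : Fin n) (P : Proposal n Tx F G), (∀ r < voting Δ t, v ∉ e.corrupt r) →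
    Message.propose P ∈ e.sent v (proposing Δ t) →
    ∀ i ∈ e.active (fastConfirming Δ t), P.chain ⪯ out i (fastConfirming Δ t)

end Run

/-! The dynamically available protocol with fast confirmations. -/

namespace Ava

variable {n Δ : ℕ} {Tx : Type*}

structure State (n : ℕ) (Tx : Type*) where
  ch : Chain Tx
  frozenView : View n Tx Unit Unit
  frozenChain : Chain Tx

def initState : State n Tx := ⟨Chain.genesis, ∅, Chain.genesis⟩

variable (e : Run n Δ Tx Unit Unit) (κ : ℕ)

def ValidProposal (P : Proposal n Tx Unit Unit) : Prop :=
  P.sender = e.proposer P.slot ∧ P.chain.p = P.slot ∧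
    ((P.certChain = Chain.genesis ∧ P.cert = ∅) ∨
      Certifies P.cert P.certChain ((P.slot : ℤ) - 1))

open Classical in
/-- The update of the frozen chain upon receiving a message in slot `t`. -/
noncomputable def handle (t : ℕ) (C : Chain Tx) : Message n Tx Unit Unit → Chain Tx
  | .vote _ => C
  | .propose P =>
    if P.slot = t ∧ ValidProposal e P ∧ C ⪯ P.certChain then P.certChain else C

/-- The fork choice at the vote round of slot `t`. -/
noncomputable def mfcVote (i : Fin n) (t : ℕ) (s : State n Tx) : Chain Tx :=
  mfc s.frozenView (e.view i (voting Δ t)) s.frozenChain t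

noncomputable def receive (i : Fin n) (r : ℕ) (s : State n Tx) : State n Tx :=
  if r % (4 * Δ) ≤ Δ then
    { s with frozenChain := (e.inbox i r).foldl (handle e (r / (4 * Δ))) s.frozenChain }
  else s

noncomputable def voteUpdate (i : Fin n) (t : ℕ) (s : State n Tx) : State n Tx :=
  let ch := Chain.longest
    {C | (C = s.ch ∨ C = kDeep κ (mfcVote e i t s) t) ∧ C ⪯ mfcVote e i t s}
  { s with ch := ch }

open Classical in
noncomputable def fastConfirmUpdate (i : Fin n) (t : ℕ) (s : State n Tx) : State n Tx :=
  let cq := fastConfirmSimple (e.view i (fastConfirming Δ t)) t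
  if cq.2 ≠ ∅ then { s with ch := cq.1 } else s

noncomputable def mergeUpdate (i : Fin n) (t : ℕ) (s : State n Tx) : State n Tx :=
  { s with
    frozenView := e.view i (merging Δ t)
    frozenChain := (fastConfirmSimple (e.view i (merging Δ t)) t).1 }

/-- The execution of round `r`: messages are handled before the round's scheduled action. -/
noncomputable def step (i : Fin n) (r : ℕ) (s : State n Tx) : State n Tx :=
  let t := r / (4 * Δ)
  let s' := receive e i r s
  if r % (4 * Δ) = Δ then voteUpdate e κ i t s'
  else if r % (4 * Δ) = 2 * Δ then fastConfirmUpdate e i t s'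
  else if r % (4 * Δ) = 3 * Δ then mergeUpdate e i t s'
  else s'

/-- The state after round `r`. -/
noncomputable def state (i : Fin n) (r : ℕ) : State n Tx :=
  e.stateBefore initState (step e κ) i (r + 1)

/-- The confirmed chain after round `r`. -/
noncomputable def confirmed (i : Fin n) (r : ℕ) : Chain Tx := (state e κ i r).ch

/-- In `e`, the honest validators follow the protocol. -/
structure IsExecution : Prop where
  propose : ∀ t i, i = e.proposer t → i ∈ e.active (proposing Δ t) →
    let V := e.view i (proposing Δ t)
    let cq := fastConfirmSimple V ((t : ℤ) - 1)
    ∃ C, e.IsExtend (mfc V V cq.1 t) t C ∧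
      e.sent i (proposing Δ t) = {Message.propose ⟨C, cq.1, cq.2, (), t, i⟩}
  vote : ∀ t, ∀ i ∈ e.active (voting Δ t),
    ∃ C, e.IsVoteChoice i (voting Δ t) t (mfcVote e i t (state e κ i (voting Δ t))) C ∧
      e.sent i (voting Δ t) = {Message.vote ⟨C, (), t, i⟩}
  nothing_else : e.SendsNothingElse

end Ava

/-! The finality component. -/

structure Checkpoint (Tx : Type*) where
  chain : Chain Tx
  c : ℕ

namespace Checkpoint

variable {Tx : Type*}

def genesis : Checkpoint Tx := ⟨Chain.genesis, 0⟩

/-- The order of checkpoints: by slot, with equality only for identical checkpoints. -/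
def Le (C D : Checkpoint Tx) : Prop := C.c < D.c ∨ C = D

end Checkpoint

/-- The finality vote `source → target`. -/
structure FinVote (Tx : Type*) where
  source : Checkpoint Tx
  target : Checkpoint Tx

/-- A vote of the full protocol. -/
abbrev FVote (n : ℕ) (Tx : Type*) := Vote n Tx (FinVote Tx)
abbrev FProposal (n : ℕ) (Tx : Type*) := Proposal n Tx (FinVote Tx) (Checkpoint Tx)
abbrev FMessage (n : ℕ) (Tx : Type*) := Message n Tx (FinVote Tx) (Checkpoint Tx)
abbrev FView (n : ℕ) (Tx : Type*) := View n Tx (FinVote Tx) (Checkpoint Tx)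
abbrev FRun (n Δ : ℕ) (Tx : Type*) := Run n Δ Tx (FinVote Tx) (Checkpoint Tx)

section Finality

variable {n : ℕ} {Tx : Type*}

def ValidLink (C D : Checkpoint Tx) : Prop := C.chain ⪯ D.chain ∧ C.c < D.c

/-- At least `2n/3` validators have a vote in `V` with the finality vote `C → D`. -/
def SupermajorityLink (V : FView n Tx) (C D : Checkpoint Tx) : Prop :=
  2 * n ≤ 3 * {k | ∃ m ∈ votesIn V, m.fin = ⟨C, D⟩ ∧ m.sender = k}.ncard

inductive Justified (V : FView n Tx) : Checkpoint Tx → Prop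
  | genesis : Justified V Checkpoint.genesis
  | link (S C : Checkpoint Tx) : Justified V S → ValidLink S C → SupermajorityLink V S C →
      Justified V C

def Finalized (V : FView n Tx) (C : Checkpoint Tx) : Prop :=
  C = Checkpoint.genesis ∨
    (Justified V C ∧ ∃ T : Checkpoint Tx, T.c = C.c + 1 ∧ ValidLink C T ∧ SupermajorityLink V C T)

open Classical in
/-- A checkpoint of maximal slot among those that satisfy `P`. -/
noncomputable def greatestCheckpoint (P : Checkpoint Tx → Prop) : Checkpoint Tx :=
  if h : ∃ C, P C ∧ ∀ D, P D → D.c ≤ C.c then h.choose else Checkpoint.genesis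

/-- The greatest justified checkpoint. -/
noncomputable def gjOf (V : FView n Tx) : Checkpoint Tx := greatestCheckpoint (Justified V)

/-- The greatest finalized checkpoint. -/
noncomputable def gfOf (V : FView n Tx) : Checkpoint Tx := greatestCheckpoint (Finalized V)

end Finality

/-! The full protocol. -/

namespace Full

variable {n Δ : ℕ} {Tx : Type*}

open Classical in
noncomputable def fastConfirm (V : FView n Tx) (t : ℤ) : Chain Tx × Set (FVote n Tx) :=
  if (gjOf V).chain ⪯ (fastConfirmSimple V t).1 then fastConfirmSimple V t
  else ((gjOf V).chain, ∅)

structure State (n : ℕ) (Tx : Type*) where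
  chAva : Chain Tx
  chFin : Chain Tx
  frozenView : FView n Tx
  frozenChain : Chain Tx
  frozenGJ : Checkpoint Tx

def initState : State n Tx :=
  ⟨Chain.genesis, Chain.genesis, ∅, Chain.genesis, Checkpoint.genesis⟩

variable (e : FRun n Δ Tx) (κ : ℕ)

def ValidProposal (P : FProposal n Tx) : Prop :=
  P.sender = e.proposer P.slot ∧ P.chain.p = P.slot ∧
    ((P.certChain = P.gj.chain ∧ P.cert = ∅) ∨ Certifies P.cert P.certChain ((P.slot : ℤ) - 1))

open Classical in
/-- The processing, at the vote round of slot `t` and with the view `V`, of a message received in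
the first rounds of the slot. -/
noncomputable def handle (t : ℕ) (V : FView n Tx) (s : State n Tx) : FMessage n Tx → State n Tx
  | .vote _ => s
  | .propose P =>
    if P.slot = t ∧ ValidProposal e P ∧ Justified V P.gj ∧ s.frozenGJ.Le P.gj then
      let C := if P.gj.chain ⪯ s.frozenChain then s.frozenChain else P.gj.chain
      { s with
        frozenGJ := P.gj
        frozenChain := if C ⪯ P.certChain then P.certChain else C }
    else s

/-- The messages received in the rounds `proposing t, …, voting t`, in the order of receipt. -/
def slotInbox (i : Fin n) (t : ℕ) : List (FMessage n Tx) :=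
  (List.range (Δ + 1)).flatMap (fun k => e.inbox i (proposing Δ t + k))

/-- The fork choice at the vote round of slot `t`. -/
noncomputable def mfcVote (i : Fin n) (t : ℕ) (s : State n Tx) : Chain Tx :=
  mfc s.frozenView (e.view i (voting Δ t)) s.frozenChain t

noncomputable def receive (i : Fin n) (t : ℕ) (s : State n Tx) : State n Tx :=
  (slotInbox e i t).foldl (handle e t (e.view i (voting Δ t))) s

noncomputable def voteUpdate (i : Fin n) (t : ℕ) (s : State n Tx) : State n Tx :=
  let ava := Chain.longest
    {C | (C = s.chAva ∨ C = kDeep κ (mfcVote e i t s) t ∨ C = s.frozenGJ.chain) ∧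
      C ⪯ mfcVote e i t s}
  { s with
    chAva := ava
    chFin := Chain.longest {C | C ⪯ ava ∧ C ⪯ (gfOf (e.view i (voting Δ t))).chain} }

open Classical in
noncomputable def fastConfirmUpdate (i : Fin n) (t : ℕ) (s : State n Tx) : State n Tx :=
  let V := e.view i (fastConfirming Δ t)
  let cand := (fastConfirm V t).1
  { s with
    chAva := if cand ⪯ s.chAva then s.chAva else cand
    chFin := (gfOf V).chain }

noncomputable def mergeUpdate (i : Fin n) (t : ℕ) (s : State n Tx) : State n Tx :=
  let V := e.view i (merging Δ t)
  { s with
    frozenView := V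
    frozenChain := (fastConfirm V t).1
    frozenGJ := gjOf V }

/-- The execution of round `r`. -/
noncomputable def step (i : Fin n) (r : ℕ) (s : State n Tx) : State n Tx :=
  let t := r / (4 * Δ)
  if r % (4 * Δ) = Δ then voteUpdate e κ i t (receive e i t s)
  else if r % (4 * Δ) = 2 * Δ then fastConfirmUpdate e i t s
  else if r % (4 * Δ) = 3 * Δ then mergeUpdate e i t s
  else s

/-- The state after round `r`. -/
noncomputable def state (i : Fin n) (r : ℕ) : State n Tx :=
  e.stateBefore initState (step e κ) i (r + 1)

/-- The available chain after round `r`. -/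
noncomputable def available (i : Fin n) (r : ℕ) : Chain Tx := (state e κ i r).chAva

/-- The target checkpoint of the finality vote in slot `t`, from the state at the vote round. -/
def target (t : ℕ) (s : State n Tx) : Checkpoint Tx :=
  if s.frozenGJ.c + 1 = t then ⟨s.chAva, t⟩ else ⟨s.frozenGJ.chain, t⟩

/-- In `e`, the honest validators follow the protocol. -/
structure IsExecution : Prop where
  propose : ∀ t i, i = e.proposer t → i ∈ e.active (proposing Δ t) →
    let V := e.view i (proposing Δ t)
    let cq := fastConfirm V ((t : ℤ) - 1)
    ∃ C, e.IsExtend (mfc V V cq.1 t) t C ∧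
      e.sent i (proposing Δ t) = {Message.propose ⟨C, cq.1, cq.2, gjOf V, t, i⟩}
  vote : ∀ t, ∀ i ∈ e.active (voting Δ t),
    let s := state e κ i (voting Δ t)
    ∃ C, e.IsVoteChoice i (voting Δ t) t (mfcVote e i t s) C ∧
      e.sent i (voting Δ t) = {Message.vote ⟨C, ⟨s.frozenGJ, target t s⟩, t, i⟩}
  nothing_else : e.SendsNothingElse

end Full

open MeasureTheory in
/-- Fair and unpredictable election: given everything decided before the election for slot `t`
(the σ-algebra `ℱ t`), each of the `n` validators is the proposer with probability `1 / n`. -/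
structure FairElection {Ω : Type*} [mΩ : MeasurableSpace Ω] {n : ℕ}
    (μ : Measure Ω) (ℱ : Filtration ℕ mΩ)
    (proposer : ℕ → Ω → Fin n) : Prop where
  revealed : ∀ t v, MeasurableSet[ℱ (t + 1)] {ω | proposer t ω = v}
  fair : ∀ t v A, MeasurableSet[ℱ t] A → μ (A ∩ {ω | proposer t ω = v}) = μ A / n

/-! The core is view merging. A relay takes at most `Δ` rounds, so the view of an honest leader at
the start of slot `t` lies between the view that a voter froze in slot `t - 1` and the view of that
voter at the vote round. A vote counted in both of the voter's views is counted in the leader's: it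
is already there, and an equivocation or a later vote that discards it would also be visible in the
larger view. The leader moreover sees no more voters than the voter does, so a majority for the
voter is a majority for the leader (`Majority.sandwich`). If the bases fit, the voter's fork choice
is therefore below the leader's (`mfc_prefix_mfc_of_sandwich`), hence below the proposal, and every
honest vote of the slot is for the proposal. With `2n/3` active voters the proposal is a candidate
for fast confirmation in each active view, and candidates are pairwise comparable because `f < n/3`;
so the confirmed chain extends the proposal. Honest votes have height at most their slot, which
keeps the leader's fork choice low enough to be extended.

In the first protocol the bases fit for free: a chain certified for the voter is a candidate for the
leader, so the voter adopts the leader's certified chain.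

In the full protocol a base can also be the chain of a justified checkpoint, which could conflict
with other bases. This is excluded by an induction over slots (`Safe`): honest votes extend every
chain locked earlier, namely targets of honest finality votes, candidates for fast confirmation and
proposals of honest leaders. What all honest votes of a slot extend has a majority in the next slot
by the sleepiness condition (`Unanimous.succ`). The delicate case is a target that is an available
chain which is merely `κ`-deep (`unanimous_target`). An honestly led slot among the last `κ` settles
it: the proposal made there is extended by all honest votes and is at least as high as the deep
chain, so the deep chain is a prefix of it.

For random proposers, each window of `κ` slots lacks an honest leader with probability at most `(1 -
h₀/n)^κ`, and a union bound over the windows finishes. -/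

/-! ### Counting and folds. -/

theorem exists_mem_inter_of_ncard_lt {α : Type*} {A B W : Set α} (hW : W.Finite) (hA : A ⊆ W)
    (hB : B ⊆ W) (h : W.ncard < A.ncard + B.ncard) : (A ∩ B).Nonempty := by
  rw [Set.nonempty_iff_ne_empty]
  intro h0
  have h1 := Set.ncard_union_add_ncard_inter A B (hW.subset hA) (hW.subset hB)
  have h2 := Set.ncard_le_ncard (Set.union_subset hA hB) hW
  rw [h0, Set.ncard_empty] at h1
  omega

theorem List.foldl_invariant {σ α : Type*} (f : σ → α → σ) (p : σ → Prop) {l : List α} {a : σ}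
    (ha : p a) (h : ∀ m ∈ l, ∀ s, p s → p (f s m)) : p (l.foldl f a) := by
  induction l generalizing a with
  | nil => exact ha
  | cons m l ih =>
    exact ih (h m (by simp) a ha) fun m' hm' => h m' (by simp [hm'])

/-- A fold that keeps `p` until it reaches `q`, keeps `q`, and reaches `q` at some element. -/
theorem List.foldl_reaches {σ α : Type*} (f : σ → α → σ) (p q : σ → Prop) {l : List α} {a : σ}
    (ha : p a) (h₁ : ∀ m ∈ l, ∀ s, p s → p (f s m) ∨ q (f s m)) (h₂ : ∀ m ∈ l, ∀ s, q s → q (f s m))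
    (h₃ : ∃ m ∈ l, ∀ s, p s → q (f s m)) : q (l.foldl f a) := by
  induction l generalizing a with
  | nil => simp at h₃
  | cons m l ih =>
    rw [List.foldl_cons]
    have h₂' : ∀ m ∈ l, ∀ s, q s → q (f s m) := fun m hm => h₂ m (by simp [hm])
    obtain ⟨m', hm', h₃⟩ := h₃
    rcases List.mem_cons.1 hm' with rfl | hm'
    · exact List.foldl_invariant f q (h₃ a ha) h₂'
    · rcases h₁ m (by simp) a ha with h | h
      · exact ih h (fun m hm => h₁ m (by simp [hm])) h₂' ⟨m', hm', h₃⟩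
      · exact List.foldl_invariant f q h h₂'

/-! ### Prefix order, heights and longest chains. -/

namespace Chain

variable {Tx : Type*} {C D E : Chain Tx} {S : Set (Chain Tx)}

theorem Prefix.refl (C : Chain Tx) : C ⪯ C := List.prefix_refl _

theorem Prefix.trans (h₁ : C ⪯ D) (h₂ : D ⪯ E) : C ⪯ E := List.IsPrefix.trans h₁ h₂

theorem genesis_prefix (C : Chain Tx) : genesis ⪯ C := List.nil_prefix

theorem Prefix.comparable (h₁ : C ⪯ E) (h₂ : D ⪯ E) : C ⪯ D ∨ D ⪯ C :=
  List.prefix_or_prefix_of_prefix h₁ h₂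

theorem p_genesis : (genesis : Chain Tx).p = -1 := rfl

/-- Slots increase strictly along a chain. Hence among comparable chains the height decides the
prefix order, and a longest element of a set of comparable chains is unique. -/
theorem eq_or_p_lt_of_prefix (h : C ⪯ D) : C = D ∨ C.p < D.p := by
  obtain ⟨l, hl⟩ := h
  rcases List.eq_nil_or_concat l with rfl | ⟨l', b, rfl⟩
  · left
    cases C
    cases D
    simpa using hl
  · right
    have hD : D.p = b.slot := by
      unfold p
      rw [← hl]
      simp
    rw [hD]
    unfold p
    split
    · omega
    · next a ha =>
      have hinc := D.increasing
      rw [← hl, List.pairwise_append] at hinc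
      have := hinc.2.2 a (List.mem_of_getLast? ha) b (by simp)
      omega

theorem Prefix.p_le (h : C ⪯ D) : C.p ≤ D.p := by
  rcases eq_or_p_lt_of_prefix h with rfl | h
  · rfl
  · exact h.le

theorem Prefix.antisymm (h₁ : C ⪯ D) (h₂ : D ⪯ C) : C = D := by
  rcases eq_or_p_lt_of_prefix h₁ with h | h
  · exact h
  · have := h₂.p_le
    omega

theorem prefix_of_comparable_of_p_le (h : C ⪯ D ∨ D ⪯ C) (hp : C.p ≤ D.p) : C ⪯ D := by
  rcases h with h | h
  · exact h
  · rcases eq_or_p_lt_of_prefix h with rfl | h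
    · exact Prefix.refl _
    · omega

theorem longest_mem_or_eq_genesis (S : Set (Chain Tx)) : longest S ∈ S ∨ longest S = genesis := by
  unfold longest
  split
  · next h => exact Or.inl h.choose_spec.1
  · exact Or.inr rfl

/-- The bound matters: without a maximal height `longest` falls back to the genesis chain. -/
theorem longest_spec (hne : S.Nonempty) {B : ℤ} (hB : ∀ C ∈ S, C.p ≤ B) :
    longest S ∈ S ∧ ∀ D ∈ S, D.p ≤ (longest S).p := by
  have h : ∃ C ∈ S, ∀ D ∈ S, D.p ≤ C.p := by
    obtain ⟨m, ⟨C, hC, rfl⟩, hm⟩ := Int.exists_greatest_of_bdd (P := fun z => ∃ C ∈ S, C.p = z)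
      ⟨B, by rintro z ⟨C, hC, rfl⟩; exact hB C hC⟩ ⟨_, hne.some, hne.some_mem, rfl⟩
    exact ⟨C, hC, fun D hD => hm _ ⟨D, hD, rfl⟩⟩
  unfold longest
  rw [dif_pos h]
  exact h.choose_spec

theorem prefix_longest (hcomp : ∀ C ∈ S, ∀ D ∈ S, C ⪯ D ∨ D ⪯ C) {B : ℤ}
    (hB : ∀ C ∈ S, C.p ≤ B) (hD : D ∈ S) : D ⪯ longest S :=
  have h := longest_spec ⟨D, hD⟩ hB
  prefix_of_comparable_of_p_le (hcomp _ hD _ h.1) (h.2 D hD)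

theorem longest_prefix_of_forall (h : ∀ C ∈ S, C ⪯ D) : longest S ⪯ D := by
  rcases longest_mem_or_eq_genesis S with h' | h'
  · exact h _ h'
  · rw [h']
    exact genesis_prefix D

end Chain

section KDeep

variable {Tx : Type*} {C D : Chain Tx} {κ t : ℕ}

theorem p_kDeep_le (κ : ℕ) (C : Chain Tx) (t : ℕ) :
    (kDeep κ C t).p ≤ (t : ℤ) - κ ∨ kDeep κ C t = Chain.genesis := by
  rcases Chain.longest_mem_or_eq_genesis {D | D ⪯ C ∧ D.p ≤ (t : ℤ) - κ} with h | h
  · exact Or.inl h.2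
  · exact Or.inr h

end KDeep

/-! ### The majority fork choice and fast-confirmation candidates. -/

section ForkChoice

variable {n : ℕ} {Tx F G : Type*} {V V' : View n Tx F G} {B C D : Chain Tx} {t : ℤ}

/-- The votes that the fork choice takes into account. -/
def countedVotes (V : View n Tx F G) (t : ℤ) : Set (Vote n Tx F) :=
  filLmd (filExp (filEq (votesIn V)) t)

theorem mem_countedVotes {m : Vote n Tx F} : m ∈ countedVotes V t ↔
    Message.vote m ∈ V ∧ ¬ EquivocatesIn (votesIn V) m.sender ∧ t - 1 ≤ (m.slot : ℤ) ∧
      ∀ m', Message.vote m' ∈ V → t - 1 ≤ (m'.slot : ℤ) → m'.sender = m.sender →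
        m'.slot ≤ m.slot := by
  constructor
  · rintro ⟨⟨⟨h₁, h₂⟩, h₃⟩, h₄⟩
    refine ⟨h₁, h₂, h₃, fun m' hm' ht hs => h₄ m' ⟨⟨hm', ?_⟩, ht⟩ hs⟩
    rwa [hs]
  · rintro ⟨h₁, h₂, h₃, h₄⟩
    exact ⟨⟨⟨h₁, h₂⟩, h₃⟩, fun m' hm' hs => h₄ m' hm'.1.1 hm'.2 hs⟩

/-- Only chain and slot are determined: two votes that differ in the finality component alone are
not an equivocation. -/
theorem countedVotes_unique {m m' : Vote n Tx F} (hm : m ∈ countedVotes V t)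
    (hm' : m' ∈ countedVotes V t) (hs : m.sender = m'.sender) :
    m.chain = m'.chain ∧ m.slot = m'.slot := by
  rw [mem_countedVotes] at hm hm'
  have hslot : m.slot = m'.slot :=
    le_antisymm (hm'.2.2.2 m hm.1 hm.2.2.1 hs) (hm.2.2.2 m' hm'.1 hm'.2.2.1 hs.symm)
  refine ⟨?_, hslot⟩
  by_contra hne
  exact hm.2.1 ⟨m, hm.1, m', hm'.1, rfl, hs.symm, hslot, hne⟩

/-- The validators whose votes count for `C` in both views. -/
def backers (V V' : View n Tx F G) (C : Chain Tx) (t : ℤ) : Set (Fin n) :=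
  {k | ∃ m ∈ countedVotes V t, ∃ m' ∈ countedVotes V' t, C ⪯ m.chain ∧ m.sender = k ∧
    m'.sender = k ∧ m'.chain = m.chain ∧ m'.slot = m.slot}

theorem ncard_support_inter (V V' : View n Tx F G) (C : Chain Tx) (t : ℤ) :
    (support V C t ∩ support V' C t).ncard = (backers V V' C t).ncard := by
  have himg : (fun x : Chain Tx × ℕ × Fin n => x.2.2) '' (support V C t ∩ support V' C t) =
      backers V V' C t := by
    ext k
    constructor
    · rintro ⟨x, ⟨⟨m, hm, hC, rfl⟩, m', hm', -, he⟩, rfl⟩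
      simp only [Prod.mk.injEq] at he
      exact ⟨m, hm, m', hm', hC, rfl, he.2.2.symm, he.1.symm, he.2.1.symm⟩
    · rintro ⟨m, hm, m', hm', hC, rfl, hs, hc, hsl⟩
      exact ⟨(m.chain, m.slot, m.sender), ⟨⟨m, hm, hC, rfl⟩, m', hm', hc ▸ hC,
        by rw [hs, hc, hsl]⟩, rfl⟩
  rw [← himg]
  refine (Set.InjOn.ncard_image ?_).symm
  rintro x ⟨⟨m, hm, -, rfl⟩, -⟩ y ⟨⟨m', hm', -, rfl⟩, -⟩ hxy
  have := countedVotes_unique hm hm' hxy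
  simp only [Prod.mk.injEq]
  exact ⟨this.1, this.2, hxy⟩

theorem backers_subset_voters : backers V V' C t ⊆ voters V' t := by
  rintro k ⟨m, -, m', hm', -, -, hs, -⟩
  rw [mem_countedVotes] at hm'
  exact ⟨m', ⟨hm'.1, hm'.2.2.1⟩, hs⟩

/-- The majority condition of the fork choice. -/
def Majority (V V' : View n Tx F G) (C : Chain Tx) (t : ℤ) : Prop :=
  (voters V' t).ncard < 2 * (backers V V' C t).ncard

theorem mfc_eq (V V' : View n Tx F G) (B : Chain Tx) (t : ℤ) :
    mfc V V' B t = Chain.longest {C | B ⪯ C ∧ (C = B ∨ Majority V V' C t)} := by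
  simp only [mfc, Majority, ncard_support_inter]

/-- Two sets of more than half of the voters share a validator, whose single counted chain extends
both. -/
theorem Majority.comparable (hC : Majority V V' C t) (hD : Majority V V' D t) :
    C ⪯ D ∨ D ⪯ C := by
  obtain ⟨k, ⟨m, hm, -, -, hCm, hk, -⟩, ⟨m', hm', -, -, hDm, hk', -⟩⟩ :
      (backers V V' C t ∩ backers V V' D t).Nonempty :=
    exists_mem_inter_of_ncard_lt (Set.toFinite (voters V' t)) backers_subset_voters
      backers_subset_voters (by unfold Majority at hC hD; omega)
  have := (countedVotes_unique hm hm' (hk.trans hk'.symm)).1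
  exact hCm.comparable (this ▸ hDm)

theorem Majority.nonempty (hC : Majority V V' C t) : (backers V V' C t).Nonempty := by
  apply Set.nonempty_of_ncard_ne_zero
  unfold Majority at hC
  omega

theorem mfc_candidates_comparable :
    ∀ C ∈ {C | B ⪯ C ∧ (C = B ∨ Majority V V' C t)},
      ∀ D ∈ {C | B ⪯ C ∧ (C = B ∨ Majority V V' C t)}, C ⪯ D ∨ D ⪯ C := by
  rintro C ⟨hBC, rfl | hC⟩ D ⟨hBD, hD⟩
  · exact Or.inl hBD
  · rcases hD with rfl | hD
    · exact Or.inr hBC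
    · exact hC.comparable hD

theorem mfc_candidates_bounded (V V' : View n Tx F G) (B : Chain Tx) (t : ℤ) :
    ∃ b : ℤ, ∀ C ∈ {C | B ⪯ C ∧ (C = B ∨ Majority V V' C t)}, C.p ≤ b := by
  classical
  -- A view may be infinite, but each validator has at most one counted chain, so only finitely many
  -- heights occur.
  have hfin : {h : ℤ | ∃ m ∈ countedVotes V t, m.chain.p = h}.Finite := by
    have : {h : ℤ | ∃ m ∈ countedVotes V t, m.chain.p = h} ⊆
        Set.range fun k : Fin n => if h : ∃ m ∈ countedVotes V t, m.sender = k
          then h.choose.chain.p else 0 := by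
      rintro _ ⟨m, hm, rfl⟩
      refine ⟨m.sender, ?_⟩
      have h : ∃ m' ∈ countedVotes V t, m'.sender = m.sender := ⟨m, hm, rfl⟩
      simp only [dif_pos h]
      rw [(countedVotes_unique h.choose_spec.1 hm h.choose_spec.2).1]
    exact (Set.finite_range _).subset this
  obtain ⟨b, hb⟩ := hfin.bddAbove
  refine ⟨max b B.p, ?_⟩
  rintro C ⟨-, rfl | hC⟩
  · exact le_max_right _ _
  · obtain ⟨k, m, hm, -, -, hCm, -⟩ := hC.nonempty
    exact (hCm.p_le.trans (hb ⟨m, hm, rfl⟩)).trans (le_max_left _ _)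

theorem mfc_mem (V V' : View n Tx F G) (B : Chain Tx) (t : ℤ) :
    B ⪯ mfc V V' B t ∧ (mfc V V' B t = B ∨ Majority V V' (mfc V V' B t) t) := by
  obtain ⟨b, hb⟩ := mfc_candidates_bounded V V' B t
  rw [mfc_eq]
  refine (Chain.longest_spec (S := {C | B ⪯ C ∧ (C = B ∨ Majority V V' C t)}) ?_ hb).1
  exact ⟨B, Chain.Prefix.refl B, Or.inl rfl⟩

theorem prefix_mfc (V V' : View n Tx F G) (B : Chain Tx) (t : ℤ) : B ⪯ mfc V V' B t :=
  (mfc_mem V V' B t).1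

theorem Majority.prefix_mfc (hC : Majority V V' C t) (hB : B ⪯ C ∨ C ⪯ B) :
    C ⪯ mfc V V' B t := by
  rcases hB with hB | hB
  · obtain ⟨b, hb⟩ := mfc_candidates_bounded V V' B t
    rw [mfc_eq]
    exact Chain.prefix_longest mfc_candidates_comparable hb ⟨hB, Or.inr hC⟩
  · exact hB.trans (_root_.prefix_mfc V V' B t)

/-- A majority in the views `V, V''` persists in a view `V'` that is between them. -/
theorem Majority.sandwich {V'' : View n Tx F G} (hC : Majority V V'' C t)
    (h₁ : votesIn V ⊆ votesIn V') (h₂ : votesIn V' ⊆ votesIn V'') : Majority V' V' C t := by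
  unfold Majority at *
  have hv : voters V' t ⊆ voters V'' t := by
    rintro k ⟨m, ⟨hm, ht⟩, hk⟩
    exact ⟨m, ⟨h₂ hm, ht⟩, hk⟩
  -- Presence of the vote passes up from `V` to `V'`; being latest and from a non-equivocating
  -- sender passes down from `V''` to `V'`.
  have hb : backers V V'' C t ⊆ backers V' V' C t := by
    rintro k ⟨m, hm, m', hm', hCm, hk, hk', hc, hs⟩
    have : m ∈ countedVotes V' t := by
      rw [mem_countedVotes] at *
      refine ⟨h₁ hm.1, ?_, hm.2.2.1, ?_⟩
      · rintro ⟨a, ha, b, hb, hak, hbk, hab, hne⟩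
        exact hm'.2.1 ⟨a, h₂ ha, b, h₂ hb, by rw [hak, hk, hk'], by rw [hbk, hk, hk'], hab, hne⟩
      · intro a ha hat has
        rw [← hs]
        exact hm'.2.2.2 a (h₂ ha) hat (by rw [has, hk, hk'])
    exact ⟨m, this, m, this, hCm, hk, hk, rfl, rfl⟩
  have := Set.ncard_le_ncard hv (Set.toFinite _)
  have := Set.ncard_le_ncard hb (Set.toFinite _)
  omega

/-- The fork choice of a voter is below the one of the proposer, given that its base is. -/
theorem mfc_prefix_mfc_of_sandwich {V V' V'' : View n Tx F G} {B B' : Chain Tx} {t : ℤ}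
    (h₁ : votesIn V ⊆ votesIn V') (h₂ : votesIn V' ⊆ votesIn V'') (hB : B' ⪯ B)
    (hB' : B ⪯ mfc V' V' B' t) : mfc V V'' B t ⪯ mfc V' V' B' t := by
  rcases mfc_mem V V'' B t with ⟨h, h' | h'⟩
  · rw [h']
    exact hB'
  · exact (h'.sandwich h₁ h₂).prefix_mfc (Or.inl (hB.trans h))

/-- Covers slot 0, where the frozen view is still empty. -/
theorem mfc_empty (V' : View n Tx F G) (B : Chain Tx) (t : ℤ) : mfc ∅ V' B t = B := by
  rcases (mfc_mem ∅ V' B t).2 with h | h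
  · exact h
  · obtain ⟨k, m, hm, -⟩ := h.nonempty
    rw [mem_countedVotes] at hm
    exact absurd hm.1 (Set.notMem_empty _)

theorem mem_fastCands : C ∈ fastCands V t ↔ 2 * n ≤
    3 * {j | ∃ m ∈ votesIn V, (m.slot : ℤ) = t ∧ C ⪯ m.chain ∧ m.sender = j}.ncard :=
  Iff.rfl

theorem fastCands_mono (h : votesIn V ⊆ votesIn V') : fastCands V t ⊆ fastCands V' t := by
  intro C hC
  have : {j | ∃ m ∈ votesIn V, (m.slot : ℤ) = t ∧ C ⪯ m.chain ∧ m.sender = j} ⊆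
      {j | ∃ m ∈ votesIn V', (m.slot : ℤ) = t ∧ C ⪯ m.chain ∧ m.sender = j} := by
    rintro j ⟨m, hm, h'⟩
    exact ⟨m, h hm, h'⟩
  have := Set.ncard_le_ncard this (Set.toFinite _)
  rw [mem_fastCands] at hC ⊢
  omega

theorem Certifies.mem_fastCands {Q : Set (Vote n Tx F)} (h : Certifies Q C t)
    (hQ : Q ⊆ votesIn V) : C ∈ fastCands V t := by
  have hsub : {j | ∃ m ∈ Q, m.sender = j} ⊆
      {j | ∃ m ∈ votesIn V, (m.slot : ℤ) = t ∧ C ⪯ m.chain ∧ m.sender = j} := by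
    rintro j ⟨m, hm, hj⟩
    exact ⟨m, hQ hm, (h.1 m hm).1, (h.1 m hm).2, hj⟩
  have := Set.ncard_le_ncard hsub (Set.toFinite _)
  have := h.2
  rw [_root_.mem_fastCands]
  omega

/-- In slot 0 certificates refer to slot `-1`, in which there are no votes. For `n = 0` every chain
would be a candidate. -/
theorem fastCands_of_neg (hn : 0 < n) (ht : t < 0) : fastCands V t = ∅ := by
  ext C
  simp only [mem_fastCands, Set.mem_empty_iff_false, iff_false]
  have : {j | ∃ m ∈ votesIn V, (m.slot : ℤ) = t ∧ C ⪯ m.chain ∧ m.sender = j} = ∅ := by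
    ext j
    simp only [Set.mem_ofPred_eq, Set.mem_empty_iff_false, iff_false]
    rintro ⟨m, -, h, -⟩
    omega
  rw [this, Set.ncard_empty]
  omega

theorem fastConfirmSimple_of_empty (h : fastCands V t = ∅) :
    fastConfirmSimple V t = (Chain.genesis, ∅) := by
  unfold fastConfirmSimple
  rw [if_neg (by rw [h]; exact Set.not_nonempty_empty)]

theorem fastConfirmSimple_fst_mem (V : View n Tx F G) (t : ℤ) :
    (fastConfirmSimple V t).1 ∈ fastCands V t ∨ (fastConfirmSimple V t).1 = Chain.genesis := by
  unfold fastConfirmSimple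
  split
  · exact Chain.longest_mem_or_eq_genesis _
  · exact Or.inr rfl

theorem fastConfirmSimple_certifies (hc : (fastConfirmSimple V t).1 ∈ fastCands V t) :
    Certifies (fastConfirmSimple V t).2 (fastConfirmSimple V t).1 t := by
  have hne : (fastCands V t).Nonempty := ⟨_, hc⟩
  unfold fastConfirmSimple at hc ⊢
  rw [if_pos hne] at hc ⊢
  refine ⟨fun m hm => hm.2, ?_⟩
  refine (mem_fastCands.1 hc).trans (le_of_eq ?_)
  congr 2
  ext j
  constructor
  · rintro ⟨m, h₁, h₂, h₃, h₄⟩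
    exact ⟨m, ⟨h₁, h₂, h₃⟩, h₄⟩
  · rintro ⟨m, ⟨h₁, h₂, h₃⟩, h₄⟩
    exact ⟨m, h₁, h₂, h₃, h₄⟩

end ForkChoice

/-! ### Arithmetic of rounds and slots. -/

section Time

variable {Δ s t : ℕ}

theorem proposing_lt_voting (hΔ : 0 < Δ) (t : ℕ) : proposing Δ t < voting Δ t := by
  unfold proposing voting
  omega

theorem voting_succ (Δ s : ℕ) : voting Δ (s + 1) = voting Δ s + 4 * Δ := by
  unfold voting
  ring

theorem proposing_succ (Δ s : ℕ) : proposing Δ (s + 1) = merging Δ s + Δ := by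
  unfold proposing merging
  ring

theorem voting_le_voting (h : s ≤ t) : voting Δ s ≤ voting Δ t :=
  Nat.add_le_add_right (Nat.mul_le_mul_left _ h) _

theorem lt_of_voting_lt (h : voting Δ s < voting Δ t) : s < t := by
  by_contra! hts
  have := voting_le_voting (Δ := Δ) hts
  omega

theorem le_of_voting_le (hΔ : 0 < Δ) (h : voting Δ s ≤ voting Δ t) : s ≤ t := by
  have : voting Δ s < voting Δ (t + 1) := by
    rw [voting_succ]
    omega
  have := lt_of_voting_lt this
  omega

theorem voting_injective (hΔ : 0 < Δ) (h : voting Δ s = voting Δ t) : s = t :=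
  le_antisymm (le_of_voting_le hΔ h.le) (le_of_voting_le hΔ h.ge)

theorem proposing_injective (hΔ : 0 < Δ) (h : proposing Δ s = proposing Δ t) : s = t :=
  voting_injective hΔ (by unfold proposing at h; unfold voting; omega)

theorem slot_mod {k : ℕ} (hk : k < 4 * Δ) (t : ℕ) : (4 * Δ * t + k) % (4 * Δ) = k := by
  rw [Nat.mul_add_mod, Nat.mod_eq_of_lt hk]

theorem slot_div {k : ℕ} (hk : k < 4 * Δ) (t : ℕ) : (4 * Δ * t + k) / (4 * Δ) = t := by
  rw [Nat.mul_add_div (by omega), Nat.div_eq_of_lt hk, add_zero]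

end Time

/-! ### Views, honest votes and quorums in a synchronous run. -/

namespace Run

variable {n Δ : ℕ} {Tx F G : Type*} {e : Run n Δ Tx F G}

/-- The honest validators send exactly one vote or proposal when they have to, and nothing else. -/
structure WellBehaved (e : Run n Δ Tx F G) : Prop where
  vote : ∀ t, ∀ i ∈ e.active (voting Δ t),
    ∃ m : Vote n Tx F, m.slot = t ∧ m.sender = i ∧ e.sent i (voting Δ t) = {Message.vote m}
  propose : ∀ t, e.proposer t ∈ e.active (proposing Δ t) →
    ∃ P : Proposal n Tx F G, P.slot = t ∧ P.sender = e.proposer t ∧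
      e.sent (e.proposer t) (proposing Δ t) = {Message.propose P}
  nothing_else : e.SendsNothingElse

/-- A vote that its sender cast while active. -/
def HonestVote (e : Run n Δ Tx F G) (m : Vote n Tx F) : Prop :=
  m.sender ∈ e.active (voting Δ m.slot) ∧ Message.vote m ∈ e.sent m.sender (voting Δ m.slot)

section Views

theorem awake_of_active {i : Fin n} {r : ℕ} (h : i ∈ e.active r) : i ∈ e.awake r := by
  rcases h.2 with h | ⟨s, hs, h⟩
  · exact h r le_rfl
  · refine h r ?_ le_rfl
    rw [voting_succ] at hs
    omega

/-- This is what the joining protocol provides: a voter of slot `s + 1` was awake at the merge round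
of slot `s` and has frozen a fresh view there. -/
theorem awake_of_active_voting_succ (hΔ : 0 < Δ) {i : Fin n} {s r : ℕ}
    (h : i ∈ e.active (voting Δ (s + 1))) (h₁ : voting Δ s + Δ ≤ r) (h₂ : r ≤ voting Δ (s + 1)) :
    i ∈ e.awake r := by
  rcases h.2 with h | ⟨s', hs, h⟩
  · exact h r h₂
  · have := voting_le_voting (Δ := Δ) (Nat.le_of_succ_le_succ (le_of_voting_le hΔ hs))
    exact h r (by omega) h₂

theorem view_mono (i : Fin n) {r r' : ℕ} (h : r ≤ r') : e.view i r ⊆ e.view i r' := by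
  rintro m ⟨a, ha, hm⟩
  exact ⟨a, ha.trans h, hm⟩

theorem votesIn_view_mono (i : Fin n) {r r' : ℕ} (h : r ≤ r') :
    votesIn (e.view i r) ⊆ votesIn (e.view i r') :=
  fun _ hm => view_mono i h hm

theorem mem_inbox_of_propose_mem_view {i : Fin n} {r : ℕ} {P : Proposal n Tx F G}
    (h : Message.propose P ∈ e.view i r) : ∃ r' ≤ r, Message.propose P ∈ e.inbox i r' := by
  obtain ⟨r', hr', h | ⟨Q, -, w, -, hw⟩⟩ := h
  · exact ⟨r', hr', h⟩
  · cases hw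

theorem mem_view_of_mem_inbox {i : Fin n} {r r' : ℕ} {m : Message n Tx F G}
    (h : m ∈ e.inbox i r') (hr : r' ≤ r) : m ∈ e.view i r :=
  ⟨r', hr, Or.inl h⟩

theorem cert_subset_view {i : Fin n} {r : ℕ} {P : Proposal n Tx F G}
    (h : Message.propose P ∈ e.view i r) : P.cert ⊆ votesIn (e.view i r) := by
  intro w hw
  obtain ⟨r', hr', h⟩ := mem_inbox_of_propose_mem_view h
  exact ⟨r', hr', Or.inr ⟨P, h, w, hw, rfl⟩⟩

theorem Synchronous.notMem_corrupt (hs : e.Synchronous) {i : Fin n} {r r' : ℕ}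
    (h : i ∉ e.corrupt r') (hr : r ≤ r') : i ∉ e.corrupt r :=
  fun h' => h (hs.corrupt_mono hr h')

/-- Gives both inclusions of view merging: from the merge round to the next propose round, and from
there to the vote round, each `Δ` rounds later. -/
theorem Synchronous.relay (hs : e.Synchronous) {i j : Fin n} {r r' : ℕ} (hj : j ∉ e.corrupt r)
    (hr : r + Δ ≤ r') (hi : i ∉ e.corrupt r') (hi' : i ∈ e.awake r') :
    votesIn (e.view j r) ⊆ votesIn (e.view i r') := by
  rintro m ⟨a, ha, hm⟩
  exact hs.relay_vote j a (hs.notMem_corrupt hj ha) m hm i r' (by omega) hi hi'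

theorem Synchronous.view_zero (hs : e.Synchronous) {i : Fin n} (hi : i ∉ e.corrupt 0) :
    e.view i 0 = ∅ := by
  ext m
  simp only [Set.mem_empty_iff_false, iff_false]
  intro hm
  cases m with
  | vote m =>
    obtain ⟨r, hr, -⟩ := hs.vote_authentic i 0 hi m hm
    omega
  | propose P =>
    obtain ⟨r, hr, -⟩ := hs.proposal_authentic i 0 hi P hm
    omega

theorem HonestVote.mem_view (hs : e.Synchronous) {m : Vote n Tx F} (hm : e.HonestVote m)
    {i : Fin n} {r : ℕ} (hr : voting Δ m.slot + Δ ≤ r) (hi : i ∉ e.corrupt r)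
    (hi' : i ∈ e.awake r) : Message.vote m ∈ e.view i r :=
  hs.delivery m.sender _ hm.1.1 _ hm.2 i r hr hi hi'

end Views

section Votes

variable (hΔ : 0 < Δ) (hs : e.Synchronous) (hw : e.WellBehaved)
include hw

theorem WellBehaved.exists_vote {t : ℕ} {i : Fin n} (hi : i ∈ e.active (voting Δ t)) :
    ∃ m, e.HonestVote m ∧ m.slot = t ∧ m.sender = i := by
  obtain ⟨m, rfl, rfl, hm⟩ := hw.vote t i hi
  exact ⟨m, ⟨hi, by rw [hm]; rfl⟩, rfl, rfl⟩

theorem HonestVote.unique {m m' : Vote n Tx F} (hm : e.HonestVote m) (hm' : e.HonestVote m')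
    (hsl : m.slot = m'.slot) (hse : m.sender = m'.sender) : m = m' := by
  obtain ⟨a, -, -, ha⟩ := hw.vote m.slot m.sender hm.1
  have h₁ := hm.2
  have h₂ := hm'.2
  rw [← hsl, ← hse, ha] at h₂
  rw [ha] at h₁
  cases h₁
  cases h₂
  rfl

theorem WellBehaved.honestVote_of_sent {i : Fin n} {r : ℕ} {m : Vote n Tx F}
    (hi : i ∉ e.corrupt r) (hm : Message.vote m ∈ e.sent i r) :
    e.HonestVote m ∧ m.sender = i ∧ r = voting Δ m.slot := by
  by_cases h : ∃ t, (r = proposing Δ t ∧ i = e.proposer t ∧ i ∈ e.active r) ∨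
      (r = voting Δ t ∧ i ∈ e.active r)
  · obtain ⟨t, ⟨rfl, rfl, ha⟩ | ⟨rfl, ha⟩⟩ := h
    · obtain ⟨P, -, -, hP⟩ := hw.propose t ha
      rw [hP] at hm
      cases hm
    · obtain ⟨m', rfl, rfl, hm'⟩ := hw.vote t i ha
      rw [hm'] at hm
      cases hm
      exact ⟨⟨ha, by rw [hm']; rfl⟩, rfl, rfl⟩
  · rw [hw.nothing_else i r hi h] at hm
    exact absurd hm (Set.notMem_empty _)

theorem WellBehaved.proposal_of_sent {i : Fin n} {r : ℕ} {P : Proposal n Tx F G}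
    (hi : i ∉ e.corrupt r) (hP : Message.propose P ∈ e.sent i r) :
    i = e.proposer P.slot ∧ i ∈ e.active (proposing Δ P.slot) ∧ r = proposing Δ P.slot ∧
      P.sender = i ∧ e.sent i r = {Message.propose P} := by
  by_cases h : ∃ t, (r = proposing Δ t ∧ i = e.proposer t ∧ i ∈ e.active r) ∨
      (r = voting Δ t ∧ i ∈ e.active r)
  · obtain ⟨t, ⟨rfl, rfl, ha⟩ | ⟨rfl, ha⟩⟩ := h
    · obtain ⟨Q, rfl, hQ, hQ'⟩ := hw.propose t ha
      rw [hQ'] at hP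
      cases hP
      exact ⟨rfl, ha, rfl, hQ, hQ'⟩
    · obtain ⟨m', -, -, hm'⟩ := hw.vote t i ha
      rw [hm'] at hP
      cases hP
  · rw [hw.nothing_else i r hi h] at hP
    exact absurd hP (Set.notMem_empty _)

include hs

theorem honestVote_of_mem_view {i : Fin n} {r : ℕ} {m : Vote n Tx F} (hi : i ∉ e.corrupt r)
    (hm : Message.vote m ∈ e.view i r) (hk : m.sender ∉ e.corrupt r) :
    e.HonestVote m ∧ voting Δ m.slot < r := by
  obtain ⟨r', hr', h⟩ := hs.vote_authentic i r hi m hm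
  have hk' := hs.notMem_corrupt hk hr'.le
  obtain ⟨h₁, -, h₂⟩ := hw.honestVote_of_sent hk' (h.resolve_left hk')
  exact ⟨h₁, h₂ ▸ hr'⟩

/-- In a slot led by an honest validator, its proposal is the only one that is received. -/
theorem HonestlyLed.unique_proposal {t : ℕ} (hl : e.HonestlyLed t) {P Q : Proposal n Tx F G}
    (hP : Message.propose P ∈ e.sent (e.proposer t) (proposing Δ t)) {i : Fin n} {r : ℕ}
    (hi : i ∉ e.corrupt r) (hr : r ≤ voting Δ t) (hQ : Message.propose Q ∈ e.view i r)
    (hslot : Q.slot = t) (hsender : Q.sender = e.proposer t) :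
    Q = P ∧ proposing Δ t < r := by
  obtain ⟨r', hr', h⟩ := hs.proposal_authentic i r hi Q hQ
  rw [hsender] at h
  have hv := hl.2 r' (by omega)
  obtain ⟨-, -, h₂, -, h₃⟩ := hw.proposal_of_sent hv (h.resolve_left hv)
  rw [hslot] at h₂
  subst h₂
  rw [h₃] at hP
  cases hP
  exact ⟨rfl, hr'⟩

include hΔ

/-- Delivery alone only says that the proposal has arrived by the vote round; authenticity adds that
it did not arrive before it was sent. So it falls into the rounds in which proposals are handled. -/
theorem HonestlyLed.exists_mem_inbox {t : ℕ} (hl : e.HonestlyLed t) {P : Proposal n Tx F G}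
    (hP : Message.propose P ∈ e.sent (e.proposer t) (proposing Δ t)) {i : Fin n}
    (hi : i ∈ e.active (voting Δ t)) :
    ∃ r, proposing Δ t ≤ r ∧ r ≤ voting Δ t ∧ Message.propose P ∈ e.inbox i r := by
  have hv := hl.2 _ (proposing_lt_voting hΔ t)
  have hmem : Message.propose P ∈ e.view i (voting Δ t) :=
    hs.delivery _ _ hv _ hP i _ le_rfl hi.1 (awake_of_active hi)
  obtain ⟨h₁, -, h₂, h₃, -⟩ := hw.proposal_of_sent hv hP
  have hslot := proposing_injective hΔ h₂
  obtain ⟨r, hr, hin⟩ := mem_inbox_of_propose_mem_view hmem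
  have := (hl.unique_proposal hs hw hP (hs.notMem_corrupt hi.1 hr) hr
    (mem_view_of_mem_inbox hin le_rfl) hslot.symm h₃).2
  exact ⟨r, this.le, hr, hin⟩

end Votes

theorem WellBehaved.honestlyLed_of_sent (hΔ : 0 < Δ) (hw : e.WellBehaved) {v : Fin n} {t : ℕ} {P : Proposal n Tx F G}
    (hv : ∀ r < voting Δ t, v ∉ e.corrupt r) (hP : Message.propose P ∈ e.sent v (proposing Δ t)) :
    e.HonestlyLed t ∧ v = e.proposer t ∧ P.slot = t := by
  obtain ⟨h₁, h₂, h₃, -⟩ := hw.proposal_of_sent (hv _ (proposing_lt_voting hΔ t)) hP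
  have := proposing_injective hΔ h₃
  subst this
  subst h₁
  exact ⟨⟨h₂, hv⟩, rfl, rfl⟩

section Quorums

variable (hc : e.Compliant) (hw : e.WellBehaved)
include hc

theorem Compliant.n_pos : 0 < n := by
  have := hc.f_lt
  omega

theorem Compliant.exists_honest_of_quorum {Q : Set (Fin n)} (hQ : 2 * n ≤ 3 * Q.ncard) :
    ∃ k ∈ Q, ∀ r, k ∉ e.corrupt r := by
  by_contra! h
  have hsub : Q ⊆ ⋃ r, e.corrupt r := fun k hk => Set.mem_iUnion.2 (h k hk)
  have := Set.ncard_le_ncard hsub (Set.toFinite _)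
  have := hc.f_lt
  unfold f at this
  omega

/-- Two quorums overlap in at least `n/3` validators, more than are ever corrupted. -/
theorem Compliant.exists_honest_of_quorums {Q Q' : Set (Fin n)} (hQ : 2 * n ≤ 3 * Q.ncard)
    (hQ' : 2 * n ≤ 3 * Q'.ncard) : ∃ k ∈ Q ∩ Q', ∀ r, k ∉ e.corrupt r := by
  by_contra! h
  have hsub : Q ∩ Q' ⊆ ⋃ r, e.corrupt r := fun k hk => Set.mem_iUnion.2 (h k hk)
  have h₁ := Set.ncard_le_ncard hsub (Set.toFinite _)
  have h₂ := Set.ncard_union_add_ncard_inter Q Q'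
  have h₃ := Set.ncard_le_card (Q ∪ Q')
  rw [Nat.card_eq_fintype_card, Fintype.card_fin] at h₃
  have := hc.f_lt
  unfold f at this
  omega

include hw

theorem exists_honestVote (t : ℕ) : ∃ m, e.HonestVote m ∧ m.slot = t := by
  have h := hc.sleepiness t
  obtain ⟨i, hi⟩ := Set.nonempty_of_ncard_ne_zero (Nat.ne_of_gt (Nat.zero_lt_of_lt h))
  obtain ⟨m, hm, hs, -⟩ := hw.exists_vote hi.1
  exact ⟨m, hm, hs⟩

theorem exists_honestVote_of_fastCands {i : Fin n} {r t : ℕ} (hi : i ∉ e.corrupt r) {C : Chain Tx}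
    (hC : C ∈ fastCands (e.view i r) t) : ∃ m, e.HonestVote m ∧ m.slot = t ∧ C ⪯ m.chain := by
  obtain ⟨k, ⟨m, hm, ht, hCm, rfl⟩, hk⟩ := hc.exists_honest_of_quorum (mem_fastCands.1 hC)
  exact ⟨m, (honestVote_of_mem_view hc.synchronous hw hi hm (hk r)).1, by exact_mod_cast ht, hCm⟩

theorem fastCands_comparable {i : Fin n} {r t : ℕ} (hi : i ∉ e.corrupt r) :
    ∀ C ∈ fastCands (e.view i r) t, ∀ D ∈ fastCands (e.view i r) t, C ⪯ D ∨ D ⪯ C := by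
  intro C hC D hD
  obtain ⟨k, ⟨⟨m, hm, ht, hCm, rfl⟩, ⟨m', hm', ht', hDm, hk'⟩⟩, hk⟩ :=
    hc.exists_honest_of_quorums (mem_fastCands.1 hC) (mem_fastCands.1 hD)
  have h₁ := (honestVote_of_mem_view hc.synchronous hw hi hm (hk r)).1
  have h₂ := (honestVote_of_mem_view hc.synchronous hw hi hm' (hk' ▸ hk r)).1
  have := h₁.unique hw h₂ (by omega) hk'.symm
  subst this
  exact hCm.comparable hDm

/-- A slot's majority that an honest validator sees includes an honest vote of the last slot. -/
theorem exists_honestVote_of_majority {j : Fin n} {s r : ℕ} (h₁ : voting Δ s + Δ ≤ r)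
    (h₂ : r ≤ voting Δ (s + 1)) (hj : j ∉ e.corrupt r) (hj' : j ∈ e.awake r)
    {V : View n Tx F G} {C : Chain Tx} (hC : Majority V (e.view j r) C ((s + 1 : ℕ) : ℤ)) :
    ∃ m, e.HonestVote m ∧ m.slot = s ∧ C ⪯ m.chain := by
  have hs := hc.synchronous
  have hcount := hc.sleepiness s
  set A := e.corrupt (voting Δ (s + 1)) with hA
  by_contra! hcon
  -- Otherwise all backers are in `A`. The honest voters of slot `s` outside `A` are then voters
  -- disjoint from the backers; as the backers are more than half of the voters, they outnumber
  -- these honest voters, and so does `A`, against the sleepiness condition.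
  have hsub : backers V (e.view j r) C ((s + 1 : ℕ) : ℤ) ⊆ A := by
    rintro k ⟨m, -, m', hm', hCm, -, rfl, hcm, -⟩
    by_contra hk
    rw [mem_countedVotes] at hm'
    obtain ⟨hv, hlt⟩ := honestVote_of_mem_view hs hw hj hm'.1 (hs.notMem_corrupt hk h₂)
    have := lt_of_voting_lt (hlt.trans_le h₂)
    have := hm'.2.2.1
    exact hcon m' hv (by push_cast at this; omega) (hcm ▸ hCm)
  have hdisj : Disjoint (e.active (voting Δ s) \ A) (backers V (e.view j r) C ((s + 1 : ℕ) : ℤ)) :=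
    Set.disjoint_left.2 fun k hk hk' => hk.2 (hsub hk')
  have hsub' : e.active (voting Δ s) \ A ∪ backers V (e.view j r) C ((s + 1 : ℕ) : ℤ) ⊆
      voters (e.view j r) ((s + 1 : ℕ) : ℤ) := by
    refine Set.union_subset ?_ backers_subset_voters
    rintro k ⟨hk, -⟩
    obtain ⟨m, hm, rfl, rfl⟩ := hw.exists_vote hk
    exact ⟨m, ⟨hm.mem_view hs h₁ hj hj', by push_cast; omega⟩, rfl⟩
  have h₃ := Set.ncard_le_ncard hsub' (Set.toFinite _)
  rw [Set.ncard_union_eq hdisj] at h₃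
  have h₄ := Set.ncard_le_ncard hsub (Set.toFinite _)
  unfold Majority at hC
  omega

/-- If the honest votes of a slot all extend `C`, then `C` has a majority in the next slot. -/
theorem majority_of_forall_honestVote {j : Fin n} {s r r' : ℕ} (h₁ : voting Δ s + Δ ≤ r)
    (hr : r ≤ r') (h₂ : r' ≤ voting Δ (s + 1)) (hj : j ∉ e.corrupt r') (hj₁ : j ∈ e.awake r)
    (hj₂ : j ∈ e.awake r') {C : Chain Tx} (hC : ∀ m, e.HonestVote m → m.slot = s → C ⪯ m.chain) :
    Majority (e.view j r) (e.view j r') C ((s + 1 : ℕ) : ℤ) := by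
  have hs := hc.synchronous
  have hcount := hc.sleepiness s
  set A := e.corrupt (voting Δ (s + 1)) with hA
  -- Expiry leaves slots at least `s`, and an honest vote seen by the vote round of `s + 1` was cast
  -- strictly before it: only slot `s` remains.
  have hlater : ∀ m : Vote n Tx F, ∀ r'' ≤ r', Message.vote m ∈ e.view j r'' → m.sender ∉ A →
      (((s + 1 : ℕ) : ℤ)) - 1 ≤ m.slot → e.HonestVote m ∧ m.slot = s := by
    intro m r'' hr'' hm hk hsl
    obtain ⟨hv, hlt⟩ := honestVote_of_mem_view hs hw (hs.notMem_corrupt hj hr'') hm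
      (hs.notMem_corrupt hk (hr''.trans h₂))
    have := lt_of_voting_lt (hlt.trans_le (hr''.trans h₂))
    exact ⟨hv, by push_cast at hsl; omega⟩
  have hcounted : ∀ r'', voting Δ s + Δ ≤ r'' → r'' ≤ r' → j ∈ e.awake r'' → ∀ m,
      e.HonestVote m → m.slot = s → m.sender ∉ A →
      m ∈ countedVotes (e.view j r'') ((s + 1 : ℕ) : ℤ) := by
    intro r'' hr₁ hr₂ haw m hm hsl hk
    rw [mem_countedVotes]
    refine ⟨hm.mem_view hs (by rw [hsl]; exact hr₁) (hs.notMem_corrupt hj hr₂) haw, ?_,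
      by push_cast; omega, ?_⟩
    · rintro ⟨a, ha, b, hb, hak, hbk, hab, hne⟩
      have hav := (honestVote_of_mem_view hs hw (hs.notMem_corrupt hj hr₂) ha
        (by rw [hak]; exact hs.notMem_corrupt hk (hr₂.trans h₂))).1
      have hbv := (honestVote_of_mem_view hs hw (hs.notMem_corrupt hj hr₂) hb
        (by rw [hbk]; exact hs.notMem_corrupt hk (hr₂.trans h₂))).1
      exact hne (by rw [hav.unique hw hbv hab (hak.trans hbk.symm)])
    · intro m' hm' hsl' hse
      rw [(hlater m' r'' hr₂ hm' (by rwa [hse]) hsl').2, hsl]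
  -- All honest voters outside `A` are backers, and every other voter is in `A`, which is the
  -- smaller set.
  have hsub : e.active (voting Δ s) \ A ⊆
      backers (e.view j r) (e.view j r') C ((s + 1 : ℕ) : ℤ) := by
    rintro k ⟨hk, hkA⟩
    obtain ⟨m, hm, hsl, rfl⟩ := hw.exists_vote hk
    exact ⟨m, hcounted r h₁ hr hj₁ m hm hsl hkA, m, hcounted r' (h₁.trans hr) le_rfl hj₂ m hm hsl hkA,
      hC m hm hsl, rfl, rfl, rfl, rfl⟩
  have hsub' : voters (e.view j r') ((s + 1 : ℕ) : ℤ) ⊆ (e.active (voting Δ s) \ A) ∪ A := by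
    rintro k ⟨m, ⟨hm, ht⟩, rfl⟩
    by_cases hk : m.sender ∈ A
    · exact Or.inr hk
    · obtain ⟨hv, hsl⟩ := hlater m r' le_rfl hm hk ht
      exact Or.inl ⟨hsl ▸ hv.1, hk⟩
  have h₃ := Set.ncard_le_ncard hsub' (Set.toFinite _)
  have h₄ := Set.ncard_union_le (e.active (voting Δ s) \ A) A
  have h₅ := Set.ncard_le_ncard hsub (Set.toFinite _)
  unfold Majority
  omega

/-- The fork choice in slot `s + 1` is not higher than `s` if its base and the honest votes of
slot `s` are not. -/
theorem p_mfc_le {j : Fin n} {s r : ℕ} (h₁ : voting Δ s + Δ ≤ r)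
    (h₂ : r ≤ voting Δ (s + 1)) (hj : j ∉ e.corrupt r) (hj' : j ∈ e.awake r)
    {V : View n Tx F G} {B : Chain Tx} (hB : B.p ≤ s)
    (hv : ∀ m, e.HonestVote m → m.slot = s → m.chain.p ≤ s) :
    (mfc V (e.view j r) B ((s + 1 : ℕ) : ℤ)).p ≤ s := by
  rcases (mfc_mem V (e.view j r) B ((s + 1 : ℕ) : ℤ)).2 with h | h
  · rwa [h]
  · obtain ⟨m, hm, hsl, hCm⟩ := exists_honestVote_of_majority hc hw h₁ h₂ hj hj' h
    exact hCm.p_le.trans (hv m hm hsl)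

/-- The height bound on honest votes bounds the candidates, each of which lies below some honest
vote; so the longest candidate exists, and by comparability it extends all others. -/
theorem prefix_fastConfirmSimple {i : Fin n} {r t : ℕ} (hi : i ∉ e.corrupt r) {C : Chain Tx}
    (hp : ∀ m, e.HonestVote m → m.chain.p ≤ m.slot)
    (hC : C ∈ fastCands (e.view i r) t) :
    C ⪯ (fastConfirmSimple (e.view i r) t).1 ∧
      (fastConfirmSimple (e.view i r) t).1 ∈ fastCands (e.view i r) t := by
  have hb : ∀ C ∈ fastCands (e.view i r) t, C.p ≤ (t : ℤ) := by
    intro D hD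
    obtain ⟨m, hm, rfl, hDm⟩ := exists_honestVote_of_fastCands hc hw hi hD
    exact hDm.p_le.trans (hp m hm)
  have hne : (fastCands (e.view i r) t).Nonempty := ⟨C, hC⟩
  unfold fastConfirmSimple
  rw [if_pos hne]
  exact ⟨Chain.prefix_longest (fastCands_comparable hc hw hi) hb hC,
    (Chain.longest_spec hne hb).1⟩

theorem fastConfirmSimple_cases {i : Fin n} {r : ℕ} (hi : i ∉ e.corrupt r) (t : ℤ)
    (hp : ∀ m, e.HonestVote m → m.chain.p ≤ m.slot) :
    fastConfirmSimple (e.view i r) t = (Chain.genesis, ∅) ∨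
      Certifies (fastConfirmSimple (e.view i r) t).2 (fastConfirmSimple (e.view i r) t).1 t := by
  rcases (fastCands (e.view i r) t).eq_empty_or_nonempty with h | ⟨C, hC⟩
  · exact Or.inl (fastConfirmSimple_of_empty h)
  · right
    have ht : 0 ≤ t := by
      by_contra ht
      rw [fastCands_of_neg hc.n_pos (by omega)] at hC
      exact hC
    lift t to ℕ using ht
    exact fastConfirmSimple_certifies (prefix_fastConfirmSimple hc hw hi hp hC).2

/-- A chain that `2n/3` validators vote for is a candidate for fast confirmation. -/
theorem mem_fastCands_of_forall_honestVote {i : Fin n} {r t : ℕ} (hr : voting Δ t + Δ ≤ r)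
    (hi : i ∉ e.corrupt r) (hi' : i ∈ e.awake r) (hq : 2 * n ≤ 3 * (e.active (voting Δ t)).ncard)
    {C : Chain Tx} (hC : ∀ m, e.HonestVote m → m.slot = t → C ⪯ m.chain) :
    C ∈ fastCands (e.view i r) t := by
  rw [mem_fastCands]
  refine hq.trans (Nat.mul_le_mul_left _ (Set.ncard_le_ncard ?_ (Set.toFinite _)))
  intro k hk
  obtain ⟨m, hm, rfl, rfl⟩ := hw.exists_vote hk
  exact ⟨m, hm.mem_view hc.synchronous hr hi hi', rfl, hC m hm rfl, rfl⟩

theorem HonestlyLed.voteChoice_eq (hΔ : 0 < Δ) {t : ℕ} (hl : e.HonestlyLed t)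
    {P : Proposal n Tx F G} (hP : Message.propose P ∈ e.sent (e.proposer t) (proposing Δ t))
    (hp : P.chain.p = t) {i : Fin n} (hi : i ∈ e.active (voting Δ t)) {B C : Chain Tx}
    (hB : B ⪯ P.chain) (hC : e.IsVoteChoice i (voting Δ t) t B C) : C = P.chain := by
  have hs := hc.synchronous
  rcases hC with ⟨Q, hQ, hslot, hsender, rfl, -⟩ | ⟨hno, -⟩
  · rw [(hl.unique_proposal hs hw hP hi.1 le_rfl hQ hslot hsender).1]
  · obtain ⟨r, -, hr, hin⟩ := hl.exists_mem_inbox hΔ hs hw hP hi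
    obtain ⟨-, -, h₁, h₂, -⟩ := hw.proposal_of_sent (hl.2 _ (proposing_lt_voting hΔ t)) hP
    exact absurd ⟨P.chain, P, mem_view_of_mem_inbox hin hr, (proposing_injective hΔ h₁).symm, h₂,
      rfl, hB, hp⟩ hno

end Quorums

section States

variable {S : Type*} {init : S} {step : Fin n → ℕ → S → S}

theorem stateBefore_succ_of_awake {i : Fin n} {r : ℕ} (h : i ∉ e.corrupt r) (h' : i ∈ e.awake r) :
    e.stateBefore init step i (r + 1) = step i r (e.stateBefore init step i r) := by
  rw [stateBefore, if_pos ⟨h, h'⟩]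

theorem stateBefore_induction {p : ℕ → S → Prop} (i : Fin n) (h0 : p 0 init)
    (hmono : ∀ r s, p r s → p (r + 1) s)
    (hstep : ∀ r s, i ∉ e.corrupt r → i ∈ e.awake r → p r s → p (r + 1) (step i r s)) (r : ℕ) :
    p r (e.stateBefore init step i r) := by
  induction r with
  | zero => exact h0
  | succ r ih =>
    rw [stateBefore]
    split
    · next h => exact hstep r _ h.1 h.2 ih
    · exact hmono r _ ih

/-- Rounds without a scheduled action can be skipped whether or not the validator is awake in them.
-/
theorem stateBefore_eq_of_step_eq (i : Fin n) {r : ℕ} :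
    ∀ k, (∀ j < k, ∀ s, step i (r + j) s = s) →
      e.stateBefore init step i (r + k) = e.stateBefore init step i r
  | 0, _ => rfl
  | k + 1, h => by
    rw [← add_assoc, stateBefore, h k k.lt_succ_self, ite_self]
    exact stateBefore_eq_of_step_eq i k fun j hj => h j (hj.trans k.lt_succ_self)

end States

/-- The messages received in the `k` rounds from round `r` on, in the order of receipt. -/
def inboxFrom (e : Run n Δ Tx F G) (i : Fin n) (r k : ℕ) : List (Message n Tx F G) :=
  (List.range k).flatMap fun j => e.inbox i (r + j)

theorem inboxFrom_succ (i : Fin n) (r k : ℕ) :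
    e.inboxFrom i r (k + 1) = e.inboxFrom i r k ++ e.inbox i (r + k) := by
  simp [inboxFrom, List.range_succ]

theorem mem_inboxFrom {i : Fin n} {r k : ℕ} {m : Message n Tx F G} :
    m ∈ e.inboxFrom i r k ↔ ∃ j < k, m ∈ e.inbox i (r + j) := by
  simp [inboxFrom]

theorem mem_view_of_mem_inboxFrom {i : Fin n} {t : ℕ} {m : Message n Tx F G}
    (h : m ∈ e.inboxFrom i (proposing Δ t) (Δ + 1)) : m ∈ e.view i (voting Δ t) := by
  obtain ⟨j, hj, hm⟩ := mem_inboxFrom.1 h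
  exact mem_view_of_mem_inbox hm (by unfold proposing voting; omega)

theorem mem_inboxFrom_of_mem_inbox {i : Fin n} {t r : ℕ} {m : Message n Tx F G}
    (h₁ : proposing Δ t ≤ r) (h₂ : r ≤ voting Δ t) (h : m ∈ e.inbox i r) :
    m ∈ e.inboxFrom i (proposing Δ t) (Δ + 1) := by
  refine mem_inboxFrom.2 ⟨r - proposing Δ t, ?_, ?_⟩
  · unfold proposing voting at *
    omega
  · rwa [Nat.add_sub_cancel' h₁]

end Run

/-! ### The dynamically available protocol. -/

namespace Ava

variable {n Δ : ℕ} {Tx : Type*} {e : Run n Δ Tx Unit Unit} {κ : ℕ}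

theorem IsExecution.wellBehaved (h : IsExecution e κ) : e.WellBehaved where
  vote t i hi := by
    obtain ⟨C, -, hC⟩ := h.vote t i hi
    exact ⟨_, rfl, rfl, hC⟩
  propose t hi := by
    obtain ⟨C, -, hC⟩ := h.propose t _ rfl hi
    exact ⟨_, rfl, rfl, hC⟩
  nothing_else := h.nothing_else

section Steps

variable (hΔ : 0 < Δ)
include hΔ

theorem step_voting (i : Fin n) (t : ℕ) (s : State n Tx) :
    step e κ i (voting Δ t) s = voteUpdate e κ i t (receive e i (voting Δ t) s) := by
  have h₁ := slot_mod (Δ := Δ) (k := Δ) (by omega) t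
  have h₂ := slot_div (Δ := Δ) (k := Δ) (by omega) t
  simp only [step, voting, h₁, h₂, if_true]

theorem step_fastConfirming (i : Fin n) (t : ℕ) (s : State n Tx) :
    step e κ i (fastConfirming Δ t) s = fastConfirmUpdate e i t s := by
  have h₁ := slot_mod (Δ := Δ) (k := 2 * Δ) (by omega) t
  have h₂ := slot_div (Δ := Δ) (k := 2 * Δ) (by omega) t
  simp only [step, fastConfirming, receive, h₁, h₂]
  rw [if_neg (by omega), if_pos trivial, if_neg (by omega)]

theorem step_merging (i : Fin n) (t : ℕ) (s : State n Tx) :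
    step e κ i (merging Δ t) s = mergeUpdate e i t s := by
  have h₁ := slot_mod (Δ := Δ) (k := 3 * Δ) (by omega) t
  have h₂ := slot_div (Δ := Δ) (k := 3 * Δ) (by omega) t
  simp only [step, merging, receive, h₁, h₂]
  rw [if_neg (by omega), if_neg (by omega), if_pos trivial, if_neg (by omega)]

theorem step_after_merging (i : Fin n) (t : ℕ) {k : ℕ} (h₁ : 0 < k) (h₂ : k < Δ)
    (s : State n Tx) : step e κ i (merging Δ t + k) s = s := by
  have h₃ := slot_mod (Δ := Δ) (k := 3 * Δ + k) (by omega) t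
  simp only [step, merging, receive, add_assoc, h₃]
  rw [if_neg (by omega), if_neg (by omega), if_neg (by omega), if_neg (by omega)]

theorem step_proposing_add (i : Fin n) (t : ℕ) {k : ℕ} (hk : k < Δ) (s : State n Tx) :
    step e κ i (proposing Δ t + k) s =
      { s with frozenChain := (e.inbox i (proposing Δ t + k)).foldl (handle e t) s.frozenChain } := by
  have h₁ := slot_mod (Δ := Δ) (k := k) (by omega) t
  have h₂ := slot_div (Δ := Δ) (k := k) (by omega) t
  simp only [step, proposing, receive, h₁, h₂]
  rw [if_neg (by omega), if_neg (by omega), if_neg (by omega), if_pos (by omega)]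

theorem receive_voting (i : Fin n) (t : ℕ) (s : State n Tx) :
    receive e i (voting Δ t) s =
      { s with frozenChain := (e.inbox i (voting Δ t)).foldl (handle e t) s.frozenChain } := by
  have h₁ := slot_mod (Δ := Δ) (k := Δ) (by omega) t
  have h₂ := slot_div (Δ := Δ) (k := Δ) (by omega) t
  simp only [receive, voting, h₁, h₂]
  rw [if_pos le_rfl]

theorem stateBefore_proposing_succ {i : Fin n} {s : ℕ} (hi : i ∉ e.corrupt (merging Δ s))
    (hi' : i ∈ e.awake (merging Δ s)) :
    e.stateBefore initState (step e κ) i (proposing Δ (s + 1)) =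
      mergeUpdate e i s (e.stateBefore initState (step e κ) i (merging Δ s)) := by
  rw [← step_merging (κ := κ) hΔ, ← Run.stateBefore_succ_of_awake (step := step e κ) hi hi',
    proposing_succ]
  have h : merging Δ s + Δ = merging Δ s + 1 + (Δ - 1) := by omega
  rw [h]
  refine Run.stateBefore_eq_of_step_eq i _ fun j hj S => ?_
  rw [add_assoc]
  exact step_after_merging hΔ i s (by omega) (by omega) S

variable (hs : e.Synchronous)
include hs

theorem frozen_stateBefore_proposing_add {i : Fin n} {t : ℕ} (hi : i ∉ e.corrupt (voting Δ t)) :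
    ∀ k ≤ Δ, (e.stateBefore initState (step e κ) i (proposing Δ t + k)).frozenView =
        (e.stateBefore initState (step e κ) i (proposing Δ t)).frozenView ∧
      (e.stateBefore initState (step e κ) i (proposing Δ t + k)).frozenChain =
        (e.inboxFrom i (proposing Δ t) k).foldl (handle e t)
          (e.stateBefore initState (step e κ) i (proposing Δ t)).frozenChain
  | 0, _ => ⟨rfl, rfl⟩
  | k + 1, hk => by
    obtain ⟨h₁, h₂⟩ := frozen_stateBefore_proposing_add hi k (by omega)
    have hi' := hs.notMem_corrupt hi (show proposing Δ t + k ≤ voting Δ t by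
      unfold proposing voting; omega)
    rw [Run.inboxFrom_succ, List.foldl_append, ← h₁, ← h₂, ← add_assoc]
    by_cases haw : i ∈ e.awake (proposing Δ t + k)
    · rw [Run.stateBefore_succ_of_awake hi' haw, step_proposing_add hΔ i t (by omega)]
      exact ⟨rfl, rfl⟩
    -- A sleeping validator has an empty inbox, so the fold over the received messages is correct
    -- for its idle rounds as well.
    · rw [hs.asleep i _ hi' haw, Run.stateBefore, if_neg (by tauto)]
      exact ⟨rfl, rfl⟩

theorem frozen_state_voting {i : Fin n} {t : ℕ} (hi : i ∈ e.active (voting Δ t)) :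
    (state e κ i (voting Δ t)).frozenView =
        (e.stateBefore initState (step e κ) i (proposing Δ t)).frozenView ∧
      (state e κ i (voting Δ t)).frozenChain =
        (e.inboxFrom i (proposing Δ t) (Δ + 1)).foldl (handle e t)
          (e.stateBefore initState (step e κ) i (proposing Δ t)).frozenChain := by
  obtain ⟨h₁, h₂⟩ := frozen_stateBefore_proposing_add (κ := κ) hΔ hs hi.1 Δ le_rfl
  have hv : proposing Δ t + Δ = voting Δ t := rfl
  rw [hv] at h₁ h₂
  rw [state, Run.stateBefore_succ_of_awake hi.1 (Run.awake_of_active hi), step_voting hΔ,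
    receive_voting hΔ, Run.inboxFrom_succ, List.foldl_append, ← h₁, ← h₂]
  exact ⟨rfl, rfl⟩

theorem frozen_state_voting_zero {i : Fin n} (hi : i ∈ e.active (voting Δ 0)) :
    (state e κ i (voting Δ 0)).frozenView = ∅ ∧
      (state e κ i (voting Δ 0)).frozenChain =
        (e.inboxFrom i (proposing Δ 0) (Δ + 1)).foldl (handle e 0) Chain.genesis := by
  have h := frozen_state_voting (κ := κ) hΔ hs hi
  have h0 : proposing Δ 0 = 0 := by simp [proposing]
  rw [h.1, h.2, h0]
  exact ⟨rfl, rfl⟩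

theorem frozen_state_voting_succ {i : Fin n} {s : ℕ} (hi : i ∈ e.active (voting Δ (s + 1))) :
    (state e κ i (voting Δ (s + 1))).frozenView = e.view i (merging Δ s) ∧
      (state e κ i (voting Δ (s + 1))).frozenChain =
        (e.inboxFrom i (proposing Δ (s + 1)) (Δ + 1)).foldl (handle e (s + 1))
          (fastConfirmSimple (e.view i (merging Δ s)) s).1 := by
  have h := frozen_state_voting (κ := κ) hΔ hs hi
  have hle : merging Δ s ≤ voting Δ (s + 1) := by
    rw [voting_succ]; unfold voting merging; omega
  rw [h.1, h.2, stateBefore_proposing_succ hΔ (hs.notMem_corrupt hi.1 hle)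
    (Run.awake_of_active_voting_succ hΔ hi (by unfold voting merging; omega) hle)]
  exact ⟨rfl, rfl⟩

end Steps

/-- The votes of an accepted certificate count as received, so the certified chain is a candidate in
the receiver's own view. -/
theorem handle_mem_or_eq {i : Fin n} {t : ℕ} {m : Message n Tx Unit Unit}
    (hm : m ∈ e.view i (voting Δ t)) (C : Chain Tx) :
    handle e t C m = C ∨ handle e t C m = Chain.genesis ∨
      handle e t C m ∈ fastCands (e.view i (voting Δ t)) ((t : ℤ) - 1) := by
  cases m with
  | vote m => exact Or.inl rfl
  | propose P =>
    simp only [handle]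
    split
    · next h =>
      obtain ⟨rfl, ⟨-, -, h | h⟩, -⟩ := h
      · exact Or.inr (Or.inl h.1)
      · exact Or.inr (Or.inr (h.mem_fastCands (Run.cert_subset_view hm)))
    · exact Or.inl rfl

theorem vote_spec (h : IsExecution e κ) {m : Vote n Tx Unit} (hm : e.HonestVote m) :
    e.IsVoteChoice m.sender (voting Δ m.slot) m.slot
      (mfcVote e m.sender m.slot (state e κ m.sender (voting Δ m.slot))) m.chain := by
  obtain ⟨C, hC, hsent⟩ := h.vote m.slot m.sender hm.1
  have h' := hm.2
  rw [hsent] at h'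
  cases m
  cases h'
  exact hC

section Execution

variable (hΔ : 0 < Δ) (hc : e.Compliant) (h : IsExecution e κ)
include hΔ hc

theorem frozenChain_voting_zero {i : Fin n} (hi : i ∈ e.active (voting Δ 0)) :
    (state e κ i (voting Δ 0)).frozenChain = Chain.genesis := by
  rw [(frozen_state_voting_zero hΔ hc.synchronous hi).2]
  refine List.foldl_invariant _ (· = Chain.genesis) rfl fun m hm C hC => ?_
  rcases handle_mem_or_eq (Run.mem_view_of_mem_inboxFrom hm) C with h' | h' | h'
  · rw [h', hC]
  · exact h'
  · rw [fastCands_of_neg hc.n_pos (by norm_num)] at h'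
    exact absurd h' (Set.notMem_empty _)

theorem frozenChain_voting_succ {i : Fin n} {s : ℕ} (hi : i ∈ e.active (voting Δ (s + 1))) :
    (state e κ i (voting Δ (s + 1))).frozenChain = Chain.genesis ∨
      (state e κ i (voting Δ (s + 1))).frozenChain ∈
        fastCands (e.view i (voting Δ (s + 1))) s := by
  rw [(frozen_state_voting_succ hΔ hc.synchronous hi).2]
  refine List.foldl_invariant _
    (fun C => C = Chain.genesis ∨ C ∈ fastCands (e.view i (voting Δ (s + 1))) s) ?_ ?_
  · rcases fastConfirmSimple_fst_mem (e.view i (merging Δ s)) s with h' | h'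
    · exact Or.inr (fastCands_mono (Run.votesIn_view_mono i (by
        rw [voting_succ]; unfold voting merging; omega)) h')
    · exact Or.inl h'
  · intro m hm C hC
    rcases handle_mem_or_eq (Run.mem_view_of_mem_inboxFrom hm) C with h' | h' | h'
    · rwa [h']
    · exact Or.inl h'
    · exact Or.inr (by simpa using h')

include h

/-- A vote not cast for a proposal is for a fork choice which is its base or lies below an honest
vote of the previous slot, and a base other than genesis is certified by such a vote too. The bound
is needed because `IsExtend` says nothing once the fork choice has reached the height of the slot.
-/
theorem p_honestVote_le (t : ℕ) : ∀ m, e.HonestVote m → m.slot = t → m.chain.p ≤ t := by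
  induction t with
  | zero =>
    intro m hm ht
    have hv := vote_spec h hm
    have ha := hm.1
    rw [ht] at hv ha
    rcases hv with ⟨P, -, -, -, -, -, hp⟩ | ⟨-, hv⟩
    · exact hp.le
    · rw [hv, mfcVote, (frozen_state_voting_zero hΔ hc.synchronous ha).1, mfc_empty,
        frozenChain_voting_zero hΔ hc ha, Chain.p_genesis]
      norm_num
  | succ s ih =>
    intro m hm ht
    have hv := vote_spec h hm
    have ha := hm.1
    rw [ht] at hv ha
    rcases hv with ⟨P, -, -, -, -, -, hp⟩ | ⟨-, hv⟩
    · exact hp.le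
    · rw [hv, mfcVote]
      refine (Run.p_mfc_le hc h.wellBehaved (by rw [voting_succ]; omega) le_rfl ha.1
        (Run.awake_of_active ha) ?_ ih).trans (by push_cast; omega)
      rcases frozenChain_voting_succ hΔ hc ha with h' | h'
      · rw [h', Chain.p_genesis]
        omega
      · obtain ⟨m', hm', hsl, hp⟩ := Run.exists_honestVote_of_fastCands hc h.wellBehaved ha.1 h'
        exact hp.p_le.trans (ih m' hm' hsl)

theorem p_honestVote_le_slot : ∀ m, e.HonestVote m → m.chain.p ≤ m.slot :=
  fun m hm => p_honestVote_le hΔ hc h m.slot m hm rfl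

theorem proposal_spec {t : ℕ} (hl : e.HonestlyLed t) {P : Proposal n Tx Unit Unit}
    (hP : Message.propose P ∈ e.sent (e.proposer t) (proposing Δ t)) :
    let V := e.view (e.proposer t) (proposing Δ t)
    P.slot = t ∧ P.certChain = (fastConfirmSimple V ((t : ℤ) - 1)).1 ∧ ValidProposal e P ∧
      mfc V V P.certChain t ⪯ P.chain := by
  intro V
  have hv := hl.1.1
  have haw := Run.awake_of_active hl.1
  have hpv := p_honestVote_le_slot hΔ hc h
  obtain ⟨C, hC, hsent⟩ := h.propose t _ rfl hl.1
  rw [hsent] at hP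
  cases hP
  have hM : (mfc V V (fastConfirmSimple V ((t : ℤ) - 1)).1 t).p < t := by
    cases t with
    | zero =>
      have : V = ∅ := hc.synchronous.view_zero hv
      rw [this, mfc_empty]
      rw [fastConfirmSimple_of_empty (fastCands_of_neg hc.n_pos (by norm_num)), Chain.p_genesis]
      norm_num
    | succ s =>
      refine Int.lt_of_le_of_lt (Run.p_mfc_le hc h.wellBehaved (s := s) ?_ ?_ hv haw ?_ ?_)
        (by push_cast; omega)
      · rw [proposing_succ]; unfold merging voting; omega
      · exact (proposing_lt_voting hΔ _).le
      · have he : ((s + 1 : ℕ) : ℤ) - 1 = s := by push_cast; ring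
        rw [he]
        rcases fastConfirmSimple_fst_mem V (s : ℤ) with h' | h'
        · obtain ⟨m, hm, hsl, hp⟩ := Run.exists_honestVote_of_fastCands hc h.wellBehaved hv h'
          exact hp.p_le.trans (p_honestVote_le hΔ hc h s m hm hsl)
        · rw [h', Chain.p_genesis]
          omega
      · exact p_honestVote_le hΔ hc h s
  obtain ⟨h₁, h₂, -⟩ := hC hM
  refine ⟨rfl, rfl, ⟨rfl, h₂, ?_⟩, h₁⟩
  rcases Run.fastConfirmSimple_cases hc h.wellBehaved hv ((t : ℤ) - 1) hpv with h' | h'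
  · exact Or.inl ⟨congrArg Prod.fst h', congrArg Prod.snd h'⟩
  · exact Or.inr h'

/-- The voter's candidates at the merge round are candidates for the leader, so the leader's
certified chain extends the frozen one and is accepted. No other proposal of the slot is valid, so
nothing replaces it. -/
theorem frozenChain_of_led {s : ℕ} (hl : e.HonestlyLed (s + 1)) {P : Proposal n Tx Unit Unit}
    (hP : Message.propose P ∈ e.sent (e.proposer (s + 1)) (proposing Δ (s + 1))) {i : Fin n}
    (hi : i ∈ e.active (voting Δ (s + 1))) :
    (state e κ i (voting Δ (s + 1))).frozenChain = P.certChain := by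
  have hs := hc.synchronous
  have hw := h.wellBehaved
  obtain ⟨hslot, hcert, hvalid, -⟩ := proposal_spec hΔ hc h hl hP
  have hle : merging Δ s ≤ voting Δ (s + 1) := by
    rw [voting_succ]; unfold voting merging; omega
  have hi₁ := hs.notMem_corrupt hi.1 hle
  have hstart : (fastConfirmSimple (e.view i (merging Δ s)) s).1 ⪯ P.certChain := by
    rw [hcert, show ((s + 1 : ℕ) : ℤ) - 1 = s by push_cast; ring]
    rcases fastConfirmSimple_fst_mem (e.view i (merging Δ s)) s with h' | h'
    · exact (Run.prefix_fastConfirmSimple hc hw hl.1.1 (p_honestVote_le_slot hΔ hc h)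
        (fastCands_mono (hs.relay hi₁ (proposing_succ Δ s).ge hl.1.1
          (Run.awake_of_active hl.1)) h')).1
    · rw [h']
      exact Chain.genesis_prefix _
  rw [(frozen_state_voting_succ hΔ hs hi).2]
  have hkey : ∀ m ∈ e.inboxFrom i (proposing Δ (s + 1)) (Δ + 1), ∀ C,
      handle e (s + 1) C m = C ∨ handle e (s + 1) C m = P.certChain := by
    intro m hm C
    cases m with
    | vote m => exact Or.inl rfl
    | propose Q =>
      simp only [handle]
      split
      · next hQ =>
        rw [(hl.unique_proposal hs hw hP hi.1 le_rfl (Run.mem_view_of_mem_inboxFrom hm) hQ.1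
          (by rw [hQ.2.1.1, hQ.1])).1]
        exact Or.inr rfl
      · exact Or.inl rfl
  refine List.foldl_reaches _ (· = (fastConfirmSimple (e.view i (merging Δ s)) s).1)
    (· = P.certChain) rfl ?_ ?_ ?_
  · rintro m hm _ rfl
    exact hkey m hm _
  · rintro m hm _ rfl
    exact (hkey m hm _).elim id id
  obtain ⟨r, hr₁, hr₂, hin⟩ := hl.exists_mem_inbox hΔ hs hw hP hi
  exact ⟨_, Run.mem_inboxFrom_of_mem_inbox hr₁ hr₂ hin, by
    rintro _ rfl
    exact if_pos ⟨hslot, hvalid, hstart⟩⟩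

/-- In a slot led by an honest validator, all honest votes are for the proposed chain. -/
theorem honestVote_eq_of_led {t : ℕ} (hl : e.HonestlyLed t) {P : Proposal n Tx Unit Unit}
    (hP : Message.propose P ∈ e.sent (e.proposer t) (proposing Δ t)) {m : Vote n Tx Unit}
    (hm : e.HonestVote m) (hslot : m.slot = t) : m.chain = P.chain := by
  have hs := hc.synchronous
  obtain ⟨hPs, -, hvalid, hext⟩ := proposal_spec hΔ hc h hl hP
  have hv := vote_spec h hm
  have hi := hm.1
  rw [hslot] at hv hi
  refine hl.voteChoice_eq hc h.wellBehaved hΔ hP (by rw [hvalid.2.1, hPs]) hi ?_ hv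
  cases t with
  | zero =>
    rw [mfcVote, (frozen_state_voting_zero hΔ hs hi).1, mfc_empty, frozenChain_voting_zero hΔ hc hi]
    exact Chain.genesis_prefix _
  | succ s =>
    rw [mfcVote, (frozen_state_voting_succ hΔ hs hi).1, frozenChain_of_led hΔ hc h hl hP hi]
    -- Voter and leader use the same base here, so only the inclusions of views remain.
    refine Chain.Prefix.trans (mfc_prefix_mfc_of_sandwich ?_ ?_ (Chain.Prefix.refl _)
      (prefix_mfc _ _ _ _)) hext
    · refine hs.relay (hs.notMem_corrupt hi.1 ?_) (proposing_succ Δ s).ge hl.1.1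
        (Run.awake_of_active hl.1)
      rw [voting_succ]; unfold voting merging; omega
    · exact hs.relay hl.1.1 le_rfl hi.1 (Run.awake_of_active hi)

theorem fastLive (t : ℕ) : e.FastLive (confirmed e κ) t := by
  intro hq v P hv hP i hi
  have hw := h.wellBehaved
  obtain ⟨hl, rfl, hslot⟩ := hw.honestlyLed_of_sent hΔ hv hP
  have haw := Run.awake_of_active hi
  have hcand : P.chain ∈ fastCands (e.view i (fastConfirming Δ t)) t := by
    refine Run.mem_fastCands_of_forall_honestVote hc hw ?_ hi.1 haw hq fun m hm hsl => ?_
    · unfold voting fastConfirming; omega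
    · rw [honestVote_eq_of_led hΔ hc h hl hP hm hsl]
      exact Chain.Prefix.refl _
  obtain ⟨h₁, h₂⟩ := Run.prefix_fastConfirmSimple hc hw hi.1 (p_honestVote_le_slot hΔ hc h) hcand
  have hne : (fastConfirmSimple (e.view i (fastConfirming Δ t)) t).2 ≠ ∅ := by
    obtain ⟨k, ⟨m, hm, -⟩, -⟩ := hc.exists_honest_of_quorum (fastConfirmSimple_certifies h₂).2
    exact Set.Nonempty.ne_empty ⟨m, hm⟩
  rw [confirmed, state, Run.stateBefore_succ_of_awake hi.1 haw, step_fastConfirming hΔ,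
    fastConfirmUpdate]
  simp only [if_pos hne]
  exact h₁

end Execution

end Ava

/-! ### Justified checkpoints. -/

section Justification

variable {n : ℕ} {Tx : Type*} {V V' : FView n Tx} {C D : Checkpoint Tx}

theorem Justified.mono (h : votesIn V ⊆ votesIn V') (hD : Justified V D) : Justified V' D := by
  induction hD with
  | genesis => exact Justified.genesis
  | link S C _ hv hl ih =>
    refine Justified.link S C ih hv (le_trans hl (Nat.mul_le_mul_left _ (Set.ncard_le_ncard ?_)))
    rintro k ⟨m, hm, h'⟩
    exact ⟨m, h hm, h'⟩

theorem Justified.cases_link (hD : Justified V D) :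
    D = Checkpoint.genesis ∨ ∃ S, ValidLink S D ∧ SupermajorityLink V S D := by
  cases hD with
  | genesis => exact Or.inl rfl
  | link S C _ hv hl => exact Or.inr ⟨S, hv, hl⟩

theorem greatestCheckpoint_spec {p : Checkpoint Tx → Prop} (hne : ∃ C, p C) {b : ℕ}
    (hb : ∀ C, p C → C.c ≤ b) :
    p (greatestCheckpoint p) ∧ ∀ D, p D → D.c ≤ (greatestCheckpoint p).c := by
  have h : ∃ C, p C ∧ ∀ D, p D → D.c ≤ C.c := by
    classical
    obtain ⟨C₀, hC₀⟩ := hne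
    have hex : ∃ k, ∃ C, p C ∧ C.c + k = b := ⟨b - C₀.c, C₀, hC₀, Nat.add_sub_cancel' (hb _ hC₀)⟩
    obtain ⟨C, hC, hk⟩ := Nat.find_spec hex
    refine ⟨C, hC, fun D hD => ?_⟩
    have := Nat.find_min' hex ⟨D, hD, Nat.add_sub_cancel' (hb _ hD)⟩
    have := hb D hD
    omega
  unfold greatestCheckpoint
  rw [dif_pos h]
  exact h.choose_spec

end Justification

/-! ### The full protocol: local state, message handling and finality targets. -/

namespace Full

variable {n Δ : ℕ} {Tx : Type*} {e : FRun n Δ Tx} {κ : ℕ}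

theorem IsExecution.wellBehaved (h : IsExecution e κ) : e.WellBehaved where
  vote t i hi := by
    obtain ⟨C, -, hC⟩ := h.vote t i hi
    exact ⟨_, rfl, rfl, hC⟩
  propose t hi := by
    obtain ⟨C, -, hC⟩ := h.propose t _ rfl hi
    exact ⟨_, rfl, rfl, hC⟩
  nothing_else := h.nothing_else

section Steps

theorem step_cases (i : Fin n) (r : ℕ) :
    (∃ t, r = voting Δ t) ∨ (∃ t, r = fastConfirming Δ t) ∨ (∃ t, r = merging Δ t) ∨
      ∀ s, step e κ i r s = s := by
  have h := Nat.div_add_mod r (4 * Δ)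
  by_cases h₁ : r % (4 * Δ) = Δ
  · exact Or.inl ⟨r / (4 * Δ), by unfold voting; omega⟩
  by_cases h₂ : r % (4 * Δ) = 2 * Δ
  · exact Or.inr (Or.inl ⟨r / (4 * Δ), by unfold fastConfirming; omega⟩)
  by_cases h₃ : r % (4 * Δ) = 3 * Δ
  · exact Or.inr (Or.inr (Or.inl ⟨r / (4 * Δ), by unfold merging; omega⟩))
  · refine Or.inr (Or.inr (Or.inr fun s => ?_))
    simp only [step, if_neg h₁, if_neg h₂, if_neg h₃]

variable (hΔ : 0 < Δ)
include hΔ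

theorem step_voting (i : Fin n) (t : ℕ) (s : State n Tx) :
    step e κ i (voting Δ t) s = voteUpdate e κ i t (receive e i t s) := by
  have h₁ := slot_mod (Δ := Δ) (k := Δ) (by omega) t
  have h₂ := slot_div (Δ := Δ) (k := Δ) (by omega) t
  simp only [step, voting, h₁, h₂, if_true]

theorem step_fastConfirming (i : Fin n) (t : ℕ) (s : State n Tx) :
    step e κ i (fastConfirming Δ t) s = fastConfirmUpdate e i t s := by
  have h₁ := slot_mod (Δ := Δ) (k := 2 * Δ) (by omega) t
  have h₂ := slot_div (Δ := Δ) (k := 2 * Δ) (by omega) t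
  simp only [step, fastConfirming, h₁, h₂]
  rw [if_neg (by omega), if_pos trivial]

theorem step_merging (i : Fin n) (t : ℕ) (s : State n Tx) :
    step e κ i (merging Δ t) s = mergeUpdate e i t s := by
  have h₁ := slot_mod (Δ := Δ) (k := 3 * Δ) (by omega) t
  have h₂ := slot_div (Δ := Δ) (k := 3 * Δ) (by omega) t
  simp only [step, merging, h₁, h₂]
  rw [if_neg (by omega), if_neg (by omega), if_pos trivial]

omit hΔ in
theorem step_before_voting (i : Fin n) (t : ℕ) {k : ℕ} (hk : k < Δ) (s : State n Tx) :
    step e κ i (proposing Δ t + k) s = s := by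
  have h₁ := slot_mod (Δ := Δ) (k := k) (by omega) t
  simp only [step, proposing, h₁]
  rw [if_neg (by omega), if_neg (by omega), if_neg (by omega)]

omit hΔ in
theorem step_after_merging (i : Fin n) (t : ℕ) {k : ℕ} (h₁ : 0 < k) (h₂ : k < Δ)
    (s : State n Tx) : step e κ i (merging Δ t + k) s = s := by
  have h₃ := slot_mod (Δ := Δ) (k := 3 * Δ + k) (by omega) t
  simp only [step, merging, add_assoc, h₃]
  rw [if_neg (by omega), if_neg (by omega), if_neg (by omega)]

omit hΔ in
theorem stateBefore_voting (i : Fin n) (t : ℕ) :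
    e.stateBefore initState (step e κ) i (voting Δ t) =
      e.stateBefore initState (step e κ) i (proposing Δ t) :=
  Run.stateBefore_eq_of_step_eq i Δ fun _ hj S => step_before_voting i t hj S

omit hΔ in
theorem stateBefore_voting_zero (i : Fin n) :
    e.stateBefore initState (step e κ) i (voting Δ 0) = initState := by
  rw [stateBefore_voting, show proposing Δ 0 = 0 by simp [proposing]]
  rfl

theorem stateBefore_voting_succ {i : Fin n} {s : ℕ} (hi : i ∉ e.corrupt (merging Δ s))
    (hi' : i ∈ e.awake (merging Δ s)) :
    e.stateBefore initState (step e κ) i (voting Δ (s + 1)) =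
      mergeUpdate e i s (e.stateBefore initState (step e κ) i (merging Δ s)) := by
  rw [stateBefore_voting, ← step_merging (κ := κ) hΔ,
    ← Run.stateBefore_succ_of_awake (step := step e κ) hi hi', proposing_succ]
  have h : merging Δ s + Δ = merging Δ s + 1 + (Δ - 1) := by omega
  rw [h]
  refine Run.stateBefore_eq_of_step_eq i _ fun j hj S => ?_
  rw [add_assoc]
  exact step_after_merging i s (by omega) (by omega) S

theorem state_voting {i : Fin n} {t : ℕ} (hi : i ∈ e.active (voting Δ t)) :
    state e κ i (voting Δ t) = voteUpdate e κ i t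
      (receive e i t (e.stateBefore initState (step e κ) i (voting Δ t))) := by
  rw [state, Run.stateBefore_succ_of_awake hi.1 (Run.awake_of_active hi), step_voting hΔ]

end Steps

section Receive

/-- The disjunction with `¬ P.gj.chain ⪯ s.frozenChain` records that the frozen chain is only ever
extended, unless it fails to extend the proposed justified chain. -/
theorem handle_cases (t : ℕ) (V : FView n Tx) (s : State n Tx) (m : FMessage n Tx) :
    handle e t V s m = s ∨ ∃ P, m = Message.propose P ∧ P.slot = t ∧ ValidProposal e P ∧
      Justified V P.gj ∧ handle e t V s m =
        { s with
          frozenGJ := P.gj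
          frozenChain := (handle e t V s m).frozenChain } ∧
      (s.frozenChain ⪯ (handle e t V s m).frozenChain ∨
        ¬ P.gj.chain ⪯ s.frozenChain) ∧ P.gj.chain ⪯ (handle e t V s m).frozenChain ∧
      ((handle e t V s m).frozenChain = s.frozenChain ∨
        (handle e t V s m).frozenChain = P.gj.chain ∨
        (handle e t V s m).frozenChain = P.certChain) := by
  cases m with
  | vote m => exact Or.inl rfl
  | propose P =>
    by_cases h : P.slot = t ∧ ValidProposal e P ∧ Justified V P.gj ∧ s.frozenGJ.Le P.gj
    · right
      refine ⟨P, rfl, h.1, h.2.1, h.2.2.1, ?_⟩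
      simp only [handle, if_pos h, true_and]
      by_cases h₁ : P.gj.chain ⪯ s.frozenChain
      · rw [if_pos h₁]
        split
        · next h₂ => exact ⟨Or.inl h₂, h₁.trans h₂, Or.inr (Or.inr rfl)⟩
        · exact ⟨Or.inl (Chain.Prefix.refl _), h₁, Or.inl rfl⟩
      · rw [if_neg h₁]
        split
        · next h₂ => exact ⟨Or.inr h₁, h₂, Or.inr (Or.inr rfl)⟩
        · exact ⟨Or.inr h₁, Chain.Prefix.refl _, Or.inr (Or.inl rfl)⟩
    · exact Or.inl (if_neg h)

theorem receive_frozenView_chAva (i : Fin n) (t : ℕ) (s : State n Tx) :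
    (receive e i t s).frozenView = s.frozenView ∧ (receive e i t s).chAva = s.chAva := by
  refine List.foldl_invariant _ (fun S : State n Tx => S.frozenView = s.frozenView ∧ S.chAva = s.chAva)
    ⟨rfl, rfl⟩ fun m _ S hS => ?_
  rcases handle_cases (e := e) t (e.view i (voting Δ t)) S m with h | ⟨P, -, -, -, -, h, -⟩
  · rwa [h]
  · rw [h]
    exact hS

theorem receive_gj_prefix (i : Fin n) (t : ℕ) {s : State n Tx}
    (hs : s.frozenGJ.chain ⪯ s.frozenChain) :
    (receive e i t s).frozenGJ.chain ⪯ (receive e i t s).frozenChain := by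
  refine List.foldl_invariant _ (fun S : State n Tx => S.frozenGJ.chain ⪯ S.frozenChain) hs fun m _ S hS => ?_
  rcases handle_cases (e := e) t (e.view i (voting Δ t)) S m with h | ⟨P, -, -, -, -, h, -, h', -⟩
  · rwa [h]
  · rw [h]
    exact h'

theorem receive_frozenGJ (i : Fin n) (t : ℕ) (s : State n Tx) :
    (receive e i t s).frozenGJ = s.frozenGJ ∨
      Justified (e.view i (voting Δ t)) (receive e i t s).frozenGJ := by
  refine List.foldl_invariant _ (fun S : State n Tx => S.frozenGJ = s.frozenGJ ∨
    Justified (e.view i (voting Δ t)) S.frozenGJ) (Or.inl rfl) fun m _ S hS => ?_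
  rcases handle_cases (e := e) t (e.view i (voting Δ t)) S m with h | ⟨P, -, -, -, hj, h, -⟩
  · rwa [h]
  · rw [h]
    exact Or.inr hj

/-- The chain `B` is justified in `V`, or a candidate for fast confirmation in slot `t`. -/
def IsBase (V : FView n Tx) (t : ℤ) (B : Chain Tx) : Prop :=
  (∃ D, Justified V D ∧ B = D.chain) ∨ B ∈ fastCands V t

theorem IsBase.mono {V V' : FView n Tx} {t : ℤ} {B : Chain Tx} (h : votesIn V ⊆ votesIn V')
    (hB : IsBase V t B) : IsBase V' t B := by
  rcases hB with ⟨D, hD, hB⟩ | hB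
  · exact Or.inl ⟨D, hD.mono h, hB⟩
  · exact Or.inr (fastCands_mono h hB)

theorem receive_isBase (i : Fin n) (t : ℕ) {s : State n Tx}
    (hs : IsBase (e.view i (voting Δ t)) ((t : ℤ) - 1) s.frozenChain) :
    IsBase (e.view i (voting Δ t)) ((t : ℤ) - 1) (receive e i t s).frozenChain := by
  refine List.foldl_invariant _
    (fun S : State n Tx => IsBase (e.view i (voting Δ t)) ((t : ℤ) - 1) S.frozenChain) hs fun m hm S hS => ?_
  rcases handle_cases (e := e) t (e.view i (voting Δ t)) S m with
    h | ⟨P, rfl, rfl, hv, hj, -, -, -, h | h | h⟩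
  · rwa [h]
  · rwa [h]
  · exact Or.inl ⟨P.gj, hj, h⟩
  · rw [h]
    rcases hv.2.2 with ⟨h', -⟩ | h'
    · exact Or.inl ⟨P.gj, hj, h'⟩
    · exact Or.inr (h'.mem_fastCands (Run.cert_subset_view (Run.mem_view_of_mem_inboxFrom hm)))

end Receive

section FastConfirm

theorem gj_prefix_fastConfirm (V : FView n Tx) (t : ℤ) :
    (gjOf V).chain ⪯ (fastConfirm V t).1 := by
  unfold fastConfirm
  split
  · next h => exact h
  · exact Chain.Prefix.refl _

theorem fastConfirm_eq_or (V : FView n Tx) (t : ℤ) :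
    ((gjOf V).chain ⪯ (fastConfirmSimple V t).1 ∧ fastConfirm V t = fastConfirmSimple V t) ∨
      (¬ (gjOf V).chain ⪯ (fastConfirmSimple V t).1 ∧ fastConfirm V t = ((gjOf V).chain, ∅)) := by
  unfold fastConfirm
  split
  · next h => exact Or.inl ⟨h, rfl⟩
  · next h => exact Or.inr ⟨h, rfl⟩

/-- The genesis chain, as the default value, is covered by the genesis checkpoint, which is always
justified. -/
theorem fastConfirm_isBase {V : FView n Tx} (hV : Justified V (gjOf V)) (t : ℤ) :
    IsBase V t (fastConfirm V t).1 := by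
  rcases fastConfirm_eq_or V t with ⟨-, h⟩ | ⟨-, h⟩
  · rw [h]
    rcases fastConfirmSimple_fst_mem V t with h' | h'
    · exact Or.inr h'
    · exact Or.inl ⟨Checkpoint.genesis, Justified.genesis, h'⟩
  · rw [h]
    exact Or.inl ⟨_, hV, rfl⟩

end FastConfirm

section Targets

/-- The checkpoint `D` is the genesis checkpoint or the target of an honest vote before round `r`. -/
def VotedTarget (e : FRun n Δ Tx) (r : ℕ) (D : Checkpoint Tx) : Prop :=
  D = Checkpoint.genesis ∨ ∃ m, e.HonestVote m ∧ voting Δ m.slot < r ∧ m.fin.target = D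

theorem VotedTarget.mono {r r' : ℕ} {D : Checkpoint Tx} (h : VotedTarget e r D) (hr : r ≤ r') :
    VotedTarget e r' D := by
  rcases h with h | ⟨m, hm, hlt, hD⟩
  · exact Or.inl h
  · exact Or.inr ⟨m, hm, hlt.trans_le hr, hD⟩

theorem target_c (t : ℕ) (s : State n Tx) : (target t s).c = t := by
  unfold target
  split <;> rfl

theorem vote_spec (h : IsExecution e κ) {m : FVote n Tx} (hm : e.HonestVote m) :
    e.IsVoteChoice m.sender (voting Δ m.slot) m.slot
      (mfcVote e m.sender m.slot (state e κ m.sender (voting Δ m.slot))) m.chain ∧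
    m.fin.target = target m.slot (state e κ m.sender (voting Δ m.slot)) := by
  obtain ⟨C, hC, hsent⟩ := h.vote m.slot m.sender hm.1
  have h' := hm.2
  rw [hsent] at h'
  have hm' := Message.vote.inj (Set.mem_singleton_iff.1 h')
  exact ⟨(congrArg Vote.chain hm').symm ▸ hC, congrArg (fun m => m.fin.target) hm'⟩

theorem mfcVote_prefix (h : IsExecution e κ) {m : FVote n Tx} (hm : e.HonestVote m) :
    mfcVote e m.sender m.slot (state e κ m.sender (voting Δ m.slot)) ⪯ m.chain := by
  rcases (vote_spec h hm).1 with ⟨P, -, -, -, -, h', -⟩ | ⟨-, h'⟩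
  · exact h'
  · rw [h']
    exact Chain.Prefix.refl _

theorem target_c_eq_slot (h : IsExecution e κ) {m : FVote n Tx} (hm : e.HonestVote m) :
    m.fin.target.c = m.slot := by
  rw [(vote_spec h hm).2, target_c]

theorem frozenGJ_prefix_frozenChain (hΔ : 0 < Δ) (i : Fin n) (r : ℕ) :
    (e.stateBefore initState (step e κ) i r).frozenGJ.chain ⪯
      (e.stateBefore initState (step e κ) i r).frozenChain := by
  refine Run.stateBefore_induction (p := fun _ (s : State n Tx) => s.frozenGJ.chain ⪯ s.frozenChain) i
    (Chain.Prefix.refl _) (fun _ _ h => h) (fun r s _ _ hs => ?_) r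
  rcases step_cases (e := e) (κ := κ) i r with ⟨t, rfl⟩ | ⟨t, rfl⟩ | ⟨t, rfl⟩ | h
  · rw [step_voting hΔ]
    exact receive_gj_prefix i t hs
  · rw [step_fastConfirming hΔ]
    exact hs
  · rw [step_merging hΔ]
    exact gj_prefix_fastConfirm _ _
  · rwa [h]

/-- Both kinds of target are below the fork choice: the available chain is selected among its
prefixes, and the justified chain stays below the frozen chain, the base of the fork choice. -/
theorem target_prefix (h : IsExecution e κ) (hΔ : 0 < Δ) {m : FVote n Tx} (hm : e.HonestVote m) :
    m.fin.target.chain ⪯ m.chain := by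
  refine Chain.Prefix.trans ?_ (mfcVote_prefix h hm)
  rw [(vote_spec h hm).2]
  unfold target
  split
  · rw [state_voting hΔ hm.1]
    exact Chain.longest_prefix_of_forall fun C hC => hC.2
  · exact (frozenGJ_prefix_frozenChain hΔ _ _).trans (prefix_mfc _ _ _ _)

end Targets

end Full

namespace Full

variable {n Δ : ℕ} {Tx : Type*} {e : FRun n Δ Tx} {κ : ℕ}

theorem frozen_voting_succ (hΔ : 0 < Δ) (hc : e.Compliant) {i : Fin n} {s : ℕ} (hi : i ∈ e.active (voting Δ (s + 1))) :
    (state e κ i (voting Δ (s + 1))).frozenView = e.view i (merging Δ s) ∧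
    (state e κ i (voting Δ (s + 1))).frozenChain = (receive e i (s + 1) (mergeUpdate e i s
      (e.stateBefore initState (step e κ) i (merging Δ s)))).frozenChain ∧
    i ∉ e.corrupt (merging Δ s) ∧ i ∈ e.awake (merging Δ s) := by
  have hle : merging Δ s ≤ voting Δ (s + 1) := by
    rw [voting_succ]; unfold voting merging; omega
  have hi₁ := hc.synchronous.notMem_corrupt hi.1 hle
  have hi₂ := Run.awake_of_active_voting_succ hΔ hi (by unfold voting merging; omega) hle
  rw [state_voting hΔ hi, stateBefore_voting_succ hΔ hi₁ hi₂]
  exact ⟨(receive_frozenView_chAva i (s + 1) _).1, rfl, hi₁, hi₂⟩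

section Execution

variable (hΔ : 0 < Δ) (hc : e.Compliant) (h : IsExecution e κ)
include hc h

/-- A supermajority link contains the vote of a validator that is never corrupted. Questions about
justified chains thus become questions about targets of honest votes. -/
theorem justified_votedTarget {i : Fin n} {r : ℕ} (hi : i ∉ e.corrupt r) {D : Checkpoint Tx}
    (hD : Justified (e.view i r) D) : VotedTarget e r D := by
  rcases hD.cases_link with h' | ⟨S, -, hl⟩
  · exact Or.inl h'
  · obtain ⟨k, ⟨m, hm, hf, rfl⟩, hk⟩ := hc.exists_honest_of_quorum hl
    obtain ⟨hv, hlt⟩ := Run.honestVote_of_mem_view hc.synchronous h.wellBehaved hi hm (hk r)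
    exact Or.inr ⟨m, hv, hlt, by rw [hf]⟩

/-- The two links share an honest voter. Honest targets carry the slot of their vote, so both links
use its single vote of that slot. The genesis checkpoint has slot 0, to which no valid link leads.
-/
theorem Justified.eq_of_c_eq {i : Fin n} {r : ℕ} (hi : i ∉ e.corrupt r) {D D' : Checkpoint Tx}
    (hD : Justified (e.view i r) D) (hD' : Justified (e.view i r) D') (hcc : D.c = D'.c) :
    D = D' := by
  have hw := h.wellBehaved
  rcases hD.cases_link with rfl | ⟨S, hlt, hl⟩
  · rcases hD'.cases_link with rfl | ⟨S', hlt', hl'⟩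
    · rfl
    · have h₁ := hlt'.2
      rw [← hcc] at h₁
      exact absurd h₁ (Nat.not_lt_zero _)
  · rcases hD'.cases_link with rfl | ⟨S', hlt', hl'⟩
    · have h₁ := hlt.2
      rw [hcc] at h₁
      exact absurd h₁ (Nat.not_lt_zero _)
    · obtain ⟨k, ⟨⟨m, hm, hf, rfl⟩, ⟨m', hm', hf', hk'⟩⟩, hk⟩ := hc.exists_honest_of_quorums hl hl'
      have hv := (Run.honestVote_of_mem_view hc.synchronous hw hi hm (hk r)).1
      have hv' := (Run.honestVote_of_mem_view hc.synchronous hw hi hm' (hk' ▸ hk r)).1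
      have h₁ := target_c_eq_slot h hv
      have h₂ := target_c_eq_slot h hv'
      rw [hf] at h₁
      rw [hf'] at h₂
      have := hv.unique hw hv' (by rw [← h₁, ← h₂]; exact hcc) hk'.symm
      subst this
      rw [hf] at hf'
      exact congrArg FinVote.target hf'

include hΔ

theorem gjOf_spec {i : Fin n} {r : ℕ} (hi : i ∉ e.corrupt r) :
    Justified (e.view i r) (gjOf (e.view i r)) ∧
      ∀ D, Justified (e.view i r) D → D.Le (gjOf (e.view i r)) := by
  -- Without a bound on the slots `gjOf` would fall back to the genesis checkpoint.
  have hb : ∀ D, Justified (e.view i r) D → D.c ≤ r := by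
    intro D hD
    rcases justified_votedTarget hc h hi hD with rfl | ⟨m, hm, hlt, rfl⟩
    · exact Nat.zero_le _
    · rw [target_c_eq_slot h hm]
      have : m.slot ≤ 4 * Δ * m.slot := Nat.le_mul_of_pos_left _ (by omega)
      unfold voting at hlt
      omega
  obtain ⟨h₁, h₂⟩ := greatestCheckpoint_spec ⟨_, Justified.genesis⟩ hb
  refine ⟨h₁, fun D hD => ?_⟩
  rcases (h₂ D hD).lt_or_eq with hlt | heq
  · exact Or.inl hlt
  · exact Or.inr (Justified.eq_of_c_eq hc h hi hD h₁ heq)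

theorem frozen_voting_zero {i : Fin n} (hi : i ∈ e.active (voting Δ 0)) :
    (state e κ i (voting Δ 0)).frozenView = ∅ ∧
      (state e κ i (voting Δ 0)).frozenChain = Chain.genesis := by
  rw [state_voting hΔ hi, stateBefore_voting_zero]
  refine ⟨(receive_frozenView_chAva i 0 _).1, ?_⟩
  rcases receive_isBase (e := e) i 0 (s := initState)
    (Or.inl ⟨Checkpoint.genesis, Justified.genesis, rfl⟩) with ⟨D, hD, hB⟩ | hB
  · rcases justified_votedTarget hc h hi.1 hD with rfl | ⟨m, -, hlt, -⟩
    · exact hB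
    · exact absurd (lt_of_voting_lt hlt) (Nat.not_lt_zero _)
  · rw [fastCands_of_neg hc.n_pos (by norm_num)] at hB
    exact absurd hB (Set.notMem_empty _)

theorem frozenChain_isBase {i : Fin n} {s : ℕ} (hi : i ∈ e.active (voting Δ (s + 1))) :
    IsBase (e.view i (voting Δ (s + 1))) s (state e κ i (voting Δ (s + 1))).frozenChain := by
  obtain ⟨-, h₁, hi₁, -⟩ := frozen_voting_succ hΔ hc hi
  have he : ((s + 1 : ℕ) : ℤ) - 1 = s := by push_cast; ring
  rw [h₁, ← he]
  refine receive_isBase i (s + 1) ?_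
  rw [he]
  exact (fastConfirm_isBase (gjOf_spec hΔ hc h hi₁).1 s).mono (Run.votesIn_view_mono i (by
    rw [voting_succ]; unfold voting merging; omega))

theorem p_isBase_le {i : Fin n} {r s : ℕ} (hi : i ∉ e.corrupt r) (hr : r ≤ voting Δ (s + 1))
    (hp : ∀ m, e.HonestVote m → m.slot ≤ s → m.chain.p ≤ m.slot) {B : Chain Tx}
    (hB : IsBase (e.view i r) s B) : B.p ≤ s := by
  rcases hB with ⟨D, hD, rfl⟩ | hB
  · rcases justified_votedTarget hc h hi hD with rfl | ⟨m, hm, hlt, rfl⟩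
    · have : Checkpoint.genesis.chain.p = -1 := Chain.p_genesis (Tx := Tx)
      omega
    · have := lt_of_voting_lt (hlt.trans_le hr)
      have h₁ := (target_prefix h hΔ hm).p_le
      have h₂ := hp m hm (by omega)
      omega
  · obtain ⟨m, hm, hsl, hpre⟩ := Run.exists_honestVote_of_fastCands hc h.wellBehaved hi hB
    have h₁ := hpre.p_le
    have h₂ := hp m hm hsl.le
    omega

/-- The induction is strong because the base may be a justified chain, whose honest vote can belong
to any earlier slot. -/
theorem p_honestVote_le (t : ℕ) : ∀ m, e.HonestVote m → m.slot = t → m.chain.p ≤ m.slot := by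
  induction t using Nat.strong_induction_on with
  | _ t ih =>
    intro m hm ht
    have hv := (vote_spec h hm).1
    have ha := hm.1
    rcases hv with ⟨P, -, -, -, -, -, hp⟩ | ⟨-, hv⟩
    · exact hp.le
    · rw [hv, mfcVote]
      rw [ht] at ha ⊢
      cases t with
      | zero =>
        rw [(frozen_voting_zero hΔ hc h ha).1, mfc_empty, (frozen_voting_zero hΔ hc h ha).2,
          Chain.p_genesis]
        norm_num
      | succ s =>
        refine (Run.p_mfc_le hc h.wellBehaved (by rw [voting_succ]; omega) le_rfl ha.1
          (Run.awake_of_active ha) ?_ ?_).trans (by push_cast; omega)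
        · exact p_isBase_le hΔ hc h ha.1 le_rfl (fun m hm hsl => ih m.slot (by omega) m hm rfl)
            (frozenChain_isBase hΔ hc h ha)
        · intro m hm hsl
          rw [← hsl]
          exact ih s (by omega) m hm hsl

theorem p_honestVote_le_slot : ∀ m, e.HonestVote m → m.chain.p ≤ m.slot :=
  fun m hm => p_honestVote_le hΔ hc h m.slot m hm rfl

theorem proposal_spec {t : ℕ} (hl : e.HonestlyLed t) {P : FProposal n Tx}
    (hP : Message.propose P ∈ e.sent (e.proposer t) (proposing Δ t)) :
    let V := e.view (e.proposer t) (proposing Δ t)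
    P.slot = t ∧ P.certChain = (fastConfirm V ((t : ℤ) - 1)).1 ∧ P.gj = gjOf V ∧
      ValidProposal e P ∧ mfc V V P.certChain t ⪯ P.chain := by
  intro V
  have hv := hl.1.1
  have haw := Run.awake_of_active hl.1
  have hpv := p_honestVote_le_slot hΔ hc h
  obtain ⟨C, hC, hsent⟩ := h.propose t _ rfl hl.1
  rw [hsent] at hP
  cases hP
  have hbase := fastConfirm_isBase (gjOf_spec hΔ hc h hv).1 ((t : ℤ) - 1)
  have hM : (mfc V V (fastConfirm V ((t : ℤ) - 1)).1 t).p < t := by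
    cases t with
    | zero =>
      have hV : V = ∅ := hc.synchronous.view_zero hv
      rw [show mfc V V (fastConfirm V (((0 : ℕ) : ℤ) - 1)).1 (0 : ℕ) =
        (fastConfirm V (((0 : ℕ) : ℤ) - 1)).1 by rw [hV, mfc_empty]]
      rcases hbase with ⟨D, hD, hB⟩ | hB
      · rcases justified_votedTarget hc h hv hD with rfl | ⟨m, -, hlt, -⟩
        · exact lt_of_eq_of_lt (congrArg Chain.p hB) (by
            change Chain.genesis.p < _
            rw [Chain.p_genesis]
            norm_num)
        · simp [proposing] at hlt
      · rw [fastCands_of_neg hc.n_pos (by norm_num)] at hB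
        exact absurd hB (Set.notMem_empty _)
    | succ s =>
      have he : ((s + 1 : ℕ) : ℤ) - 1 = s := by push_cast; ring
      rw [he] at hbase ⊢
      refine Int.lt_of_le_of_lt (Run.p_mfc_le hc h.wellBehaved (s := s) ?_ ?_ hv haw ?_ ?_)
        (by push_cast; omega)
      · rw [proposing_succ]; unfold merging voting; omega
      · exact (proposing_lt_voting hΔ _).le
      · exact p_isBase_le hΔ hc h hv (proposing_lt_voting hΔ _).le (fun m hm _ => hpv m hm) hbase
      · rintro m hm rfl
        exact hpv m hm
  obtain ⟨h₁, h₂, -⟩ := hC hM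
  refine ⟨rfl, rfl, rfl, ⟨rfl, h₂, ?_⟩, h₁⟩
  rcases fastConfirm_eq_or V ((t : ℤ) - 1) with ⟨hg, hf⟩ | ⟨-, hf⟩
  · rcases Run.fastConfirmSimple_cases hc h.wellBehaved hv ((t : ℤ) - 1) hpv with h' | h'
    -- The justified chain is below genesis, hence equal to it, so the empty certificate is valid.
    · have hf' := hf.trans h'
      left
      refine ⟨?_, congrArg Prod.snd hf'⟩
      rw [congrArg Prod.fst h'] at hg
      exact (congrArg Prod.fst hf').trans (hg.antisymm (Chain.genesis_prefix _)).symm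
    · right
      exact (congrArg (fun x => Certifies x.2 x.1 ((t : ℤ) - 1)) hf).mpr h'
  · exact Or.inl ⟨congrArg Prod.fst hf, congrArg Prod.snd hf⟩

end Execution

/-! ### Safety of locked chains, one slot to the next. -/

/-- A chain is locked in slot `c` if it is the target of an honest vote, a candidate for fast
confirmation in the view of an honest validator, or the proposal of an honest leader. -/
inductive Locked (e : FRun n Δ Tx) (C : Chain Tx) (c : ℕ) : Prop
  | target (m : FVote n Tx) (hm : e.HonestVote m) (hs : m.slot = c) (hC : m.fin.target.chain = C)
  | fast (i : Fin n) (hi : i ∉ e.corrupt (fastConfirming Δ c))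
      (hC : C ∈ fastCands (e.view i (fastConfirming Δ c)) c)
  | led (P : FProposal n Tx) (hl : e.HonestlyLed c)
      (hP : Message.propose P ∈ e.sent (e.proposer c) (proposing Δ c)) (hC : P.chain = C)

/-- All honest votes of slot `u` extend `C`. -/
def Unanimous (e : FRun n Δ Tx) (C : Chain Tx) (u : ℕ) : Prop :=
  ∀ m, e.HonestVote m → m.slot = u → C ⪯ m.chain

/-- The honest votes of slot `u` extend all chains that were locked before. -/
def Safe (e : FRun n Δ Tx) (u : ℕ) : Prop :=
  ∀ c < u, ∀ C, Locked e C c → Unanimous e C u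

theorem VotedTarget.unanimous {s : ℕ} (hA : Safe e s) {D : Checkpoint Tx}
    (hD : VotedTarget e (voting Δ s) D) : Unanimous e D.chain s := by
  rcases hD with rfl | ⟨m, hm, hlt, rfl⟩
  · exact fun _ _ _ => Chain.genesis_prefix _
  · exact hA m.slot (lt_of_voting_lt hlt) _ (Locked.target m hm rfl rfl)

section Safety

variable (hΔ : 0 < Δ) (hc : e.Compliant) (h : IsExecution e κ)
include hΔ hc h

/-- The quorums of the link and of the candidate share an honest validator. Its slot-`s` vote
extends the candidate, and also the justified chain: by `hA` if the finality vote was cast earlier,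
and as its own target otherwise. -/
theorem justified_comparable_fastCands {s : ℕ} (hA : Safe e s) {i j : Fin n} {r r' : ℕ}
    (hi : i ∉ e.corrupt r) (hr : r ≤ voting Δ (s + 1)) (hj : j ∉ e.corrupt r')
    {D : Checkpoint Tx} (hD : Justified (e.view i r) D) {C : Chain Tx}
    (hC : C ∈ fastCands (e.view j r') s) : C ⪯ D.chain ∨ D.chain ⪯ C := by
  have hw := h.wellBehaved
  have hs := hc.synchronous
  rcases hD.cases_link with rfl | ⟨S, -, hl⟩
  · exact Or.inr (Chain.genesis_prefix _)
  · obtain ⟨k, ⟨⟨m, hm, hf, rfl⟩, ⟨m', hm', hsl, hCm, hk'⟩⟩, hk⟩ :=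
      hc.exists_honest_of_quorums hl (mem_fastCands.1 hC)
    obtain ⟨hv, hlt⟩ := Run.honestVote_of_mem_view hs hw hi hm (hk r)
    have hv' := (Run.honestVote_of_mem_view hs hw hj hm' (hk' ▸ hk r')).1
    have hslot := lt_of_voting_lt (hlt.trans_le hr)
    have hsl' : m'.slot = s := by exact_mod_cast hsl
    have hDm : D.chain ⪯ m'.chain := by
      have hfD : m.fin.target.chain = D.chain := by rw [hf]
      rcases Nat.lt_succ_iff_lt_or_eq.1 hslot with hlt' | heq
      · exact hA m.slot hlt' _ (Locked.target m hv rfl hfD) m' hv' hsl'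
      · rw [← hv.unique hw hv' (by omega) hk'.symm, ← hfD]
        exact target_prefix h hΔ hv
    exact hCm.comparable hDm

/-- Both chains lie below a common honest vote of slot `s`. -/
theorem isBase_comparable {s : ℕ} (hA : Safe e s) {j : Fin n} {r : ℕ} (hj : j ∉ e.corrupt r)
    (hr : r ≤ voting Δ (s + 1)) {B C : Chain Tx} (hB : IsBase (e.view j r) s B)
    (hC : Unanimous e C s) : B ⪯ C ∨ C ⪯ B := by
  have hw := h.wellBehaved
  have key : ∃ m, e.HonestVote m ∧ m.slot = s ∧ B ⪯ m.chain := by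
    rcases hB with ⟨D, hD, rfl⟩ | hB
    · obtain ⟨m', hm', hsl'⟩ := Run.exists_honestVote hc hw s
      rcases justified_votedTarget hc h hj hD with rfl | ⟨m, hm, hlt, rfl⟩
      · exact ⟨m', hm', hsl', Chain.genesis_prefix _⟩
      · rcases Nat.lt_succ_iff_lt_or_eq.1 (lt_of_voting_lt (hlt.trans_le hr)) with hlt' | heq
        · exact ⟨m', hm', hsl', hA _ hlt' _ (Locked.target m hm rfl rfl) m' hm' hsl'⟩
        · exact ⟨m, hm, heq, target_prefix h hΔ hm⟩
    · exact Run.exists_honestVote_of_fastCands hc hw hj hB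
  obtain ⟨m, hm, hsl, hBm⟩ := key
  exact hBm.comparable (hC m hm hsl)

/-- What the honest votes of a slot agree on, those of the next slot agree on. -/
theorem Unanimous.succ {s : ℕ} (hA : Safe e s) {C : Chain Tx} (hC : Unanimous e C s) :
    Unanimous e C (s + 1) := by
  intro m hm hsl
  have ha := hm.1
  refine Chain.Prefix.trans ?_ (mfcVote_prefix h hm)
  rw [hsl] at ha ⊢
  obtain ⟨hview, -, hi₁, hi₂⟩ := frozen_voting_succ hΔ hc ha
  rw [mfcVote, hview]
  refine Majority.prefix_mfc ?_ (isBase_comparable hΔ hc h hA ha.1 le_rfl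
    (frozenChain_isBase hΔ hc h ha) hC)
  exact Run.majority_of_forall_honestVote hc h.wellBehaved (by unfold merging voting; omega)
    (by rw [voting_succ]; unfold merging voting; omega) le_rfl ha.1 hi₂ (Run.awake_of_active ha) hC

/-- When the justified chain overrides the fast-confirmed one, it is comparable to it but not below
it, so it extends it. -/
theorem prefix_fastConfirm {s : ℕ} (hA : Safe e s) {j : Fin n} {r : ℕ} (hj : j ∉ e.corrupt r)
    (hr : r ≤ voting Δ (s + 1)) {C : Chain Tx} (hC : C ∈ fastCands (e.view j r) s) :
    C ⪯ (fastConfirm (e.view j r) s).1 := by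
  obtain ⟨h₁, h₂⟩ := Run.prefix_fastConfirmSimple hc h.wellBehaved hj
    (p_honestVote_le_slot hΔ hc h) hC
  rcases fastConfirm_eq_or (e.view j r) s with ⟨-, hf⟩ | ⟨hg, hf⟩
  · rwa [hf]
  · rw [hf]
    exact h₁.trans ((justified_comparable_fastCands hΔ hc h hA hj hr hj
      (gjOf_spec hΔ hc h hj).1 h₂).resolve_right hg)

/-- The votes are relayed before the merge round, so `C` is below every frozen chain there; it must
then survive the proposals of the next slot. -/
theorem unanimous_succ_of_fastCands {s : ℕ} (hA : Safe e s) {i : Fin n}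
    (hi : i ∉ e.corrupt (fastConfirming Δ s)) {C : Chain Tx}
    (hC : C ∈ fastCands (e.view i (fastConfirming Δ s)) s) : Unanimous e C (s + 1) := by
  intro m hm hsl
  have ha := hm.1
  refine Chain.Prefix.trans ?_ (mfcVote_prefix h hm)
  rw [hsl] at ha ⊢
  obtain ⟨-, hchain, hi₁, hi₂⟩ := frozen_voting_succ hΔ hc ha
  have hle : merging Δ s ≤ voting Δ (s + 1) := by
    rw [voting_succ]; unfold merging voting; omega
  refine Chain.Prefix.trans ?_ (prefix_mfc _ _ _ _)
  rw [hchain]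
  have hstart : C ⪯ (fastConfirm (e.view m.sender (merging Δ s)) s).1 :=
    prefix_fastConfirm hΔ hc h hA hi₁ hle (fastCands_mono (hc.synchronous.relay hi
      (by unfold fastConfirming merging; omega) hi₁ hi₂) hC)
  refine List.foldl_invariant _ (fun S : State n Tx => C ⪯ S.frozenChain) hstart fun a _ S hS => ?_
  rcases handle_cases (e := e) (s + 1) (e.view m.sender (voting Δ (s + 1))) S a with
    h' | ⟨P, -, -, -, hj, -, h' | h', hg, -⟩
  · rwa [h']
  · exact hS.trans h'
  -- A justified chain below `C` would be below the frozen chain and would not have displaced it.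
  · rcases justified_comparable_fastCands hΔ hc h hA ha.1 le_rfl hi hj hC with h₁ | h₁
    · exact h₁.trans hg
    · exact absurd (h₁.trans hS) h'

/-- Equality with the leader's certified chain can fail, since the voter may keep a longer chain.
Being caught between that chain and the leader's fork choice is enough for
`mfc_prefix_mfc_of_sandwich`. -/
theorem frozenChain_of_led {s : ℕ} (hA : Safe e s) (hl : e.HonestlyLed (s + 1))
    {P : FProposal n Tx}
    (hP : Message.propose P ∈ e.sent (e.proposer (s + 1)) (proposing Δ (s + 1))) {i : Fin n}
    (hi : i ∈ e.active (voting Δ (s + 1))) :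
    let V := e.view (e.proposer (s + 1)) (proposing Δ (s + 1))
    P.certChain ⪯ (state e κ i (voting Δ (s + 1))).frozenChain ∧
      (state e κ i (voting Δ (s + 1))).frozenChain ⪯ mfc V V P.certChain ((s + 1 : ℕ) : ℤ) := by
  intro V
  have hs := hc.synchronous
  have hw := h.wellBehaved
  have hv := hl.1.1
  have haw := Run.awake_of_active hl.1
  have hvr : proposing Δ (s + 1) ≤ voting Δ (s + 1) := (proposing_lt_voting hΔ _).le
  obtain ⟨hslot, hcert, hgj, hvalid, -⟩ := proposal_spec hΔ hc h hl hP
  have he : ((s + 1 : ℕ) : ℤ) - 1 = s := by push_cast; ring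
  rw [he] at hcert
  obtain ⟨-, hchain, hi₁, hi₂⟩ := frozen_voting_succ hΔ hc hi
  have hsub : votesIn (e.view i (merging Δ s)) ⊆ votesIn V :=
    hs.relay hi₁ (proposing_succ Δ s).ge hv haw
  have hgi := gjOf_spec hΔ hc h hi₁
  have hgv := gjOf_spec hΔ hc h hv
  have hle := hgv.2 _ (hgi.1.mono hsub)
  have hgcert : P.gj.chain ⪯ P.certChain := by
    rw [hgj, hcert]
    exact gj_prefix_fastConfirm _ _
  set M := mfc V V P.certChain ((s + 1 : ℕ) : ℤ) with hM
  have hcM : P.certChain ⪯ M := prefix_mfc _ _ _ _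
  have hstart : (fastConfirm (e.view i (merging Δ s)) s).1 ⪯ M := by
    rcases fastConfirm_eq_or (e.view i (merging Δ s)) s with ⟨-, hf⟩ | ⟨-, hf⟩
    · rw [hf]
      rcases fastConfirmSimple_fst_mem (e.view i (merging Δ s)) s with h' | h'
      · refine Chain.Prefix.trans ?_ hcM
        rw [hcert]
        exact prefix_fastConfirm hΔ hc h hA hv hvr (fastCands_mono hsub h')
      · rw [h']
        exact Chain.genesis_prefix _
    · rw [hf]
      -- A greater checkpoint need not have a chain that extends the smaller one's. But if the
      -- leader's is strictly greater, the voter's was targeted before slot `s`, so all honest votes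
      -- of slot `s` extend its chain and give it a majority in the leader's view.
      rcases hle with hlt | heq
      · have hU : Unanimous e (gjOf (e.view i (merging Δ s))).chain s := by
          rcases justified_votedTarget hc h hi₁ hgi.1 with h' | ⟨m, hm, -, h'⟩
          · rw [h']
            exact fun _ _ _ => Chain.genesis_prefix _
          · refine hA m.slot ?_ _ (Locked.target m hm rfl (by rw [h']))
            rw [← target_c_eq_slot h hm, h']
            refine hlt.trans_le ?_
            rcases justified_votedTarget hc h hv hgv.1 with h'' | ⟨m', hm', hlt', h''⟩
            · rw [h'']
              exact Nat.zero_le _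
            · rw [← h'', target_c_eq_slot h hm']
              exact Nat.le_of_lt_succ (lt_of_voting_lt (hlt'.trans_le hvr))
        refine Majority.prefix_mfc ?_ (isBase_comparable hΔ hc h hA hv hvr ?_ hU)
        · exact Run.majority_of_forall_honestVote hc hw (by
            rw [proposing_succ]; unfold merging voting; omega) le_rfl hvr hv haw haw hU
        · rw [hcert]
          exact fastConfirm_isBase hgv.1 s
      · refine Chain.Prefix.trans ?_ hcM
        change (gjOf (e.view i (merging Δ s))).chain ⪯ _
        rw [heq, ← hgj]
        exact hgcert
  have honly : ∀ m ∈ e.inboxFrom i (proposing Δ (s + 1)) (Δ + 1), ∀ S : State n Tx,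
      handle e (s + 1) (e.view i (voting Δ (s + 1))) S m = S ∨ m = Message.propose P := by
    intro m hm S
    rcases handle_cases (e := e) (s + 1) (e.view i (voting Δ (s + 1))) S m with
      h' | ⟨Q, rfl, hQ, hQ', -⟩
    · exact Or.inl h'
    · rw [(hl.unique_proposal hs hw hP hi.1 le_rfl (Run.mem_view_of_mem_inboxFrom hm) hQ
        (by rw [hQ'.1, hQ])).1]
      exact Or.inr rfl
  have hjust : Justified (e.view i (voting Δ (s + 1))) P.gj := by
    rw [hgj]
    exact hgv.1.mono (hs.relay hv le_rfl hi.1 (Run.awake_of_active hi))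
  have hstep : ∀ S : State n Tx, S.frozenGJ.Le P.gj → S.frozenChain ⪯ M →
      (handle e (s + 1) (e.view i (voting Δ (s + 1))) S (Message.propose P)).frozenGJ = P.gj ∧
      P.certChain ⪯
        (handle e (s + 1) (e.view i (voting Δ (s + 1))) S (Message.propose P)).frozenChain ∧
      (handle e (s + 1) (e.view i (voting Δ (s + 1))) S (Message.propose P)).frozenChain ⪯ M := by
    intro S hS hSM
    have hcond : P.slot = s + 1 ∧ ValidProposal e P ∧
        Justified (e.view i (voting Δ (s + 1))) P.gj ∧ S.frozenGJ.Le P.gj :=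
      ⟨hslot, hvalid, hjust, hS⟩
    simp only [handle, if_pos hcond, true_and]
    by_cases h₁ : P.gj.chain ⪯ S.frozenChain
    · rw [if_pos h₁]
      split
      · exact ⟨Chain.Prefix.refl _, hcM⟩
      · next h₂ => exact ⟨(hSM.comparable hcM).resolve_left h₂, hSM⟩
    · rw [if_neg h₁, if_pos hgcert]
      exact ⟨Chain.Prefix.refl _, hcM⟩
  rw [hchain]
  refine (List.foldl_reaches _ (fun S : State n Tx => S.frozenGJ.Le P.gj ∧ S.frozenChain ⪯ M)
    (fun S : State n Tx => S.frozenGJ = P.gj ∧ P.certChain ⪯ S.frozenChain ∧ S.frozenChain ⪯ M)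
    ⟨?_, hstart⟩ ?_ ?_ ?_).2
  · rw [hgj]
    exact hle
  · intro m hm S hS
    rcases honly m hm S with h' | rfl
    · rw [h']
      exact Or.inl hS
    · exact Or.inr (hstep S hS.1 hS.2)
  · intro m hm S hS
    rcases honly m hm S with h' | rfl
    · rw [h']
      exact hS
    · exact hstep S (Or.inr hS.1) hS.2.2
  · obtain ⟨r, hr₁, hr₂, hin⟩ := hl.exists_mem_inbox hΔ hs hw hP hi
    exact ⟨_, Run.mem_inboxFrom_of_mem_inbox hr₁ hr₂ hin, fun S hS => hstep S hS.1 hS.2⟩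

/-- In a slot led by an honest validator, all honest votes are for the proposed chain. -/
theorem honestVote_eq_of_led {t : ℕ} (hA : ∀ s < t, Safe e s) (hl : e.HonestlyLed t)
    {P : FProposal n Tx} (hP : Message.propose P ∈ e.sent (e.proposer t) (proposing Δ t))
    {m : FVote n Tx} (hm : e.HonestVote m) (hslot : m.slot = t) : m.chain = P.chain := by
  have hs := hc.synchronous
  obtain ⟨hPs, -, -, hvalid, hext⟩ := proposal_spec hΔ hc h hl hP
  have hv := (vote_spec h hm).1
  have hi := hm.1
  rw [hslot] at hv hi
  refine hl.voteChoice_eq hc h.wellBehaved hΔ hP (by rw [hvalid.2.1, hPs]) hi ?_ hv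
  cases t with
  | zero =>
    rw [mfcVote, (frozen_voting_zero hΔ hc h hi).1, mfc_empty, (frozen_voting_zero hΔ hc h hi).2]
    exact Chain.genesis_prefix _
  | succ s =>
    obtain ⟨hview, -, hi₁, -⟩ := frozen_voting_succ hΔ hc hi
    obtain ⟨h₁, h₂⟩ := frozenChain_of_led hΔ hc h (hA s s.lt_succ_self) hl hP hi
    rw [mfcVote, hview]
    exact (mfc_prefix_mfc_of_sandwich (hs.relay hi₁ (proposing_succ Δ s).ge hl.1.1
      (Run.awake_of_active hl.1)) (hs.relay hl.1.1 le_rfl hi.1 (Run.awake_of_active hi))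
      h₁ h₂).trans hext

end Safety

end Full

/-! ### Available chains and the induction over slots. -/

namespace Full

variable {n Δ : ℕ} {Tx : Type*} {e : FRun n Δ Tx} {κ : ℕ}

/-- The possible values of an available chain before round `r`: the genesis chain, a chain that
was `κ`-deep in some earlier slot, or a chain that was locked in some earlier slot. -/
def IsAvailable (e : FRun n Δ Tx) (κ r : ℕ) (C : Chain Tx) : Prop :=
  C = Chain.genesis ∨ (∃ c, voting Δ c < r ∧ C.p ≤ (c : ℤ) - κ) ∨
    ∃ c, voting Δ c < r ∧ Locked e C c

theorem IsAvailable.mono {r r' : ℕ} {C : Chain Tx} (hC : IsAvailable e κ r C) (hr : r ≤ r') :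
    IsAvailable e κ r' C := by
  rcases hC with hC | ⟨c, hc, hC⟩ | ⟨c, hc, hC⟩
  · exact Or.inl hC
  · exact Or.inr (Or.inl ⟨c, hc.trans_le hr, hC⟩)
  · exact Or.inr (Or.inr ⟨c, hc.trans_le hr, hC⟩)

theorem VotedTarget.isAvailable {r : ℕ} {D : Checkpoint Tx} (hD : VotedTarget e r D) (κ : ℕ) :
    IsAvailable e κ r D.chain := by
  rcases hD with rfl | ⟨m, hm, hlt, rfl⟩
  · exact Or.inl rfl
  · exact Or.inr (Or.inr ⟨m.slot, hlt, Locked.target m hm rfl rfl⟩)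

section Execution

variable (hΔ : 0 < Δ) (hc : e.Compliant) (h : IsExecution e κ)
include hc h

theorem votedTarget_receive {i : Fin n} {t : ℕ} (hi : i ∉ e.corrupt (voting Δ t)) {s : State n Tx}
    (hs : VotedTarget e (voting Δ t) s.frozenGJ) :
    VotedTarget e (voting Δ t) (receive e i t s).frozenGJ := by
  rcases receive_frozenGJ (e := e) i t s with h' | h'
  · rwa [h']
  · exact justified_votedTarget hc h hi h'

include hΔ

/-- An available chain may have been adopted many slots ago. The invariant keeps the origin that
makes it harmless as a later target. -/
theorem stateBefore_votedTarget_isAvailable (i : Fin n) (r : ℕ) :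
    VotedTarget e r (e.stateBefore initState (step e κ) i r).frozenGJ ∧
      IsAvailable e κ r (e.stateBefore initState (step e κ) i r).chAva := by
  refine Run.stateBefore_induction
    (p := fun r (s : State n Tx) => VotedTarget e r s.frozenGJ ∧ IsAvailable e κ r s.chAva) i
    ⟨Or.inl rfl, Or.inl rfl⟩ (fun r s hs => ⟨hs.1.mono r.le_succ, hs.2.mono r.le_succ⟩)
    (fun r s hi _ hs => ?_) r
  rcases step_cases (e := e) (κ := κ) i r with ⟨t, rfl⟩ | ⟨t, rfl⟩ | ⟨t, rfl⟩ | h'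
  · rw [step_voting hΔ]
    have hgj := (votedTarget_receive hc h hi hs.1).mono (Nat.le_succ _)
    refine ⟨hgj, ?_⟩
    rcases Chain.longest_mem_or_eq_genesis {C | (C = (receive e i t s).chAva ∨
      C = kDeep κ (mfcVote e i t (receive e i t s)) t ∨ C = (receive e i t s).frozenGJ.chain) ∧
      C ⪯ mfcVote e i t (receive e i t s)} with ⟨h' | h' | h', -⟩ | h'
    · simp only [voteUpdate]
      rw [h'.trans (receive_frozenView_chAva i t s).2]
      exact hs.2.mono (Nat.le_succ _)
    · simp only [voteUpdate, h']
      rcases p_kDeep_le κ (mfcVote e i t (receive e i t s)) t with h'' | h''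
      · exact Or.inr (Or.inl ⟨t, Nat.lt_succ_self _, h''⟩)
      · exact Or.inl h''
    · simp only [voteUpdate, h']
      exact hgj.isAvailable κ
    · simp only [voteUpdate, h']
      exact Or.inl rfl
  · rw [step_fastConfirming hΔ]
    refine ⟨hs.1.mono (Nat.le_succ _), ?_⟩
    simp only [fastConfirmUpdate]
    split
    · exact hs.2.mono (Nat.le_succ _)
    · rcases fastConfirm_eq_or (e.view i (fastConfirming Δ t)) t with ⟨-, hf⟩ | ⟨-, hf⟩
      · rw [hf]
        rcases fastConfirmSimple_fst_mem (e.view i (fastConfirming Δ t)) t with h' | h'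
        · exact Or.inr (Or.inr ⟨t, by unfold voting fastConfirming; omega, Locked.fast i hi h'⟩)
        · exact Or.inl h'
      · rw [hf]
        exact ((justified_votedTarget hc h hi (gjOf_spec hΔ hc h hi).1).mono
          (Nat.le_succ _)).isAvailable κ
  · rw [step_merging hΔ]
    exact ⟨(justified_votedTarget hc h hi (gjOf_spec hΔ hc h hi).1).mono (Nat.le_succ _),
      hs.2.mono (Nat.le_succ _)⟩
  · rw [h']
    exact ⟨hs.1.mono (Nat.le_succ _), hs.2.mono (Nat.le_succ _)⟩

/-- A chain that an honest vote of slot `s` extends and that is `κ`-deep is below the proposal of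
an honest leader, and therefore extended by the honest votes of the next slot. -/
theorem unanimous_of_deep {s : ℕ} (hA : Safe e s)
    (hW : κ ≤ s → ∃ g, s - κ ≤ g ∧ g < s ∧ e.HonestlyLed g) {C : Chain Tx} {m : FVote n Tx}
    (hm : e.HonestVote m) (hsl : m.slot = s) (hCm : C ⪯ m.chain) (hC : C.p ≤ (s : ℤ) - κ) :
    Unanimous e C s := by
  by_cases hs : κ ≤ s
  · obtain ⟨g, h₁, h₂, hl⟩ := hW hs
    obtain ⟨P, hslot, -, hsent⟩ := h.wellBehaved.propose g hl.1
    have hP : Message.propose P ∈ e.sent (e.proposer g) (proposing Δ g) := by rw [hsent]; rfl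
    have hU := hA g h₂ _ (Locked.led P hl hP rfl)
    obtain ⟨-, -, -, hvalid, -⟩ := proposal_spec hΔ hc h hl hP
    have hp := hvalid.2.1
    -- The proposal has height `g ≥ s - κ`, at least that of `C`, and both lie below the vote `m`.
    have hpre : C ⪯ P.chain :=
      Chain.prefix_of_comparable_of_p_le (hCm.comparable (hU m hm hsl)) (by omega)
    exact fun m' hm' hsl' => hpre.trans (hU m' hm' hsl')
  -- Here `s < κ`, so `C` has height at most `-1` and is the genesis chain.
  · rcases Chain.eq_or_p_lt_of_prefix (Chain.genesis_prefix C) with h' | h'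
    · rw [← h']
      exact fun _ _ _ => Chain.genesis_prefix _
    · rw [Chain.p_genesis] at h'
      omega

/-- Targets of the current slot are not yet covered by `Safe`. A justified chain was targeted
earlier; an available chain is genesis, justified, locked earlier or deep, and only the deep case
uses the honestly led slot. -/
theorem unanimous_target {s : ℕ} (hA : Safe e s)
    (hW : κ ≤ s → ∃ g, s - κ ≤ g ∧ g < s ∧ e.HonestlyLed g) {m : FVote n Tx}
    (hm : e.HonestVote m) (hsl : m.slot = s) : Unanimous e m.fin.target.chain s := by
  have ha := hm.1
  have hpre := target_prefix h hΔ hm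
  obtain ⟨hgj, hava⟩ := stateBefore_votedTarget_isAvailable hΔ hc h m.sender (voting Δ s)
  rw [(vote_spec h hm).2, hsl] at hpre ⊢
  rw [hsl] at ha
  have hgj' := (votedTarget_receive hc h ha.1 hgj).unanimous hA
  rw [state_voting hΔ ha] at hpre ⊢
  set S := receive e m.sender s (e.stateBefore initState (step e κ) m.sender (voting Δ s)) with hS
  unfold target at hpre ⊢
  split
  · next hcond =>
    rw [if_pos hcond] at hpre
    have hdeep : ∀ C : Chain Tx, C ⪯ m.chain → C.p ≤ (s : ℤ) - κ → Unanimous e C s :=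
      fun C => unanimous_of_deep hΔ hc h hA hW hm hsl
    simp only [voteUpdate] at hpre ⊢
    rcases Chain.longest_mem_or_eq_genesis {C | (C = S.chAva ∨
      C = kDeep κ (mfcVote e m.sender s S) s ∨ C = S.frozenGJ.chain) ∧
      C ⪯ mfcVote e m.sender s S} with ⟨h' | h' | h', -⟩ | h'
    · rw [h'] at hpre ⊢
      rw [(receive_frozenView_chAva _ _ _).2] at hpre ⊢
      rcases hava with h'' | ⟨c, hlt, h''⟩ | ⟨c, hlt, h''⟩
      · rw [h'']
        exact fun _ _ _ => Chain.genesis_prefix _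
      · have := lt_of_voting_lt hlt
        exact hdeep _ hpre (by omega)
      · exact hA c (lt_of_voting_lt hlt) _ h''
    · rw [h'] at hpre ⊢
      rcases p_kDeep_le κ (mfcVote e m.sender s S) s with h'' | h''
      · exact hdeep _ hpre h''
      · rw [h'']
        exact fun _ _ _ => Chain.genesis_prefix _
    · rw [h']
      exact hgj'
    · rw [h']
      exact fun _ _ _ => Chain.genesis_prefix _
  · exact hgj'

/-- Older locks persist by unanimity. Of the chains locked in slot `s` itself, targets and led
proposals are unanimous already in slot `s`, while candidates enter slot `s + 1` through the frozen
chains. -/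
theorem Safe.succ {s : ℕ} (hA : ∀ s' ≤ s, Safe e s')
    (hW : κ ≤ s → ∃ g, s - κ ≤ g ∧ g < s ∧ e.HonestlyLed g) : Safe e (s + 1) := by
  have hs := hA s le_rfl
  intro c hcs C hC
  rcases Nat.lt_succ_iff_lt_or_eq.1 hcs with hlt | rfl
  · exact Unanimous.succ hΔ hc h hs (hs c hlt C hC)
  · cases hC with
    | target m hm hsl hC =>
      rw [← hC]
      exact Unanimous.succ hΔ hc h hs (unanimous_target hΔ hc h hs hW hm hsl)
    | fast i hi hC => exact unanimous_succ_of_fastCands hΔ hc h hs hi hC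
    | led P hl hP hC =>
      refine Unanimous.succ hΔ hc h hs fun m hm hsl => ?_
      rw [honestVote_eq_of_led hΔ hc h (fun s' hs' => hA s' hs'.le) hl hP hm hsl, hC]
      exact Chain.Prefix.refl _

theorem safe_of_led {t : ℕ} (hW : ∀ s, s + κ ≤ t → ∃ g, s ≤ g ∧ g < s + κ ∧ e.HonestlyLed g) :
    ∀ s ≤ t, Safe e s := by
  intro s
  induction s using Nat.strong_induction_on with
  | _ s ih =>
    intro hst
    cases s with
    | zero => exact fun c hc' => absurd hc' (Nat.not_lt_zero _)
    | succ s =>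
      refine Safe.succ hΔ hc h (fun s' hs' => ih s' (by omega) (by omega)) fun hκ => ?_
      obtain ⟨g, h₁, h₂, hl⟩ := hW (s - κ) (by omega)
      exact ⟨g, h₁, by omega, hl⟩

theorem fastLive {t : ℕ} (hW : ∀ s, s + κ ≤ t → ∃ g, s ≤ g ∧ g < s + κ ∧ e.HonestlyLed g) :
    e.FastLive (available e κ) t := by
  intro hq v P hv hP i hi
  have hw := h.wellBehaved
  have hA := safe_of_led hΔ hc h hW
  obtain ⟨hl, rfl, -⟩ := hw.honestlyLed_of_sent hΔ hv hP
  have haw := Run.awake_of_active hi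
  have heq : ∀ m, e.HonestVote m → m.slot = t → m.chain = P.chain := fun m hm hsl =>
    honestVote_eq_of_led hΔ hc h (fun s hs => hA s hs.le) hl hP hm hsl
  have hcand : P.chain ∈ fastCands (e.view i (fastConfirming Δ t)) t := by
    refine Run.mem_fastCands_of_forall_honestVote hc hw ?_ hi.1 haw hq fun m hm hsl => ?_
    · unfold voting fastConfirming; omega
    · rw [heq m hm hsl]
      exact Chain.Prefix.refl _
  have hfc : P.chain ⪯ (fastConfirm (e.view i (fastConfirming Δ t)) t).1 :=
    prefix_fastConfirm hΔ hc h (hA t le_rfl) hi.1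
      (by rw [voting_succ]; unfold fastConfirming voting; omega) hcand
  rw [available, state, Run.stateBefore_succ_of_awake hi.1 haw, step_fastConfirming hΔ]
  simp only [fastConfirmUpdate]
  split
  · next h' => exact hfc.trans h'
  · exact hfc

end Execution

end Full

/-! ### Random proposers. -/

open MeasureTheory in
/-- Whatever was decided before, the proposer of a slot avoids a set of at least `h₀` validators
with probability at most `1 - h₀ / n`. -/
theorem FairElection.measure_inter_avoid_le {Ω : Type*} [mΩ : MeasurableSpace Ω] {n : ℕ}
    {μ : Measure Ω} [IsProbabilityMeasure μ] {ℱ : Filtration ℕ mΩ} {proposer : ℕ → Ω → Fin n}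
    (hf : FairElection μ ℱ proposer) {H : ℕ → Ω → Set (Fin n)}
    (hH : ∀ t v, MeasurableSet[ℱ t] {ω | v ∈ H t ω}) {h₀ : ℕ} (hn : 0 < n)
    (hh : ∀ t ω, h₀ ≤ (H t ω).ncard) (t : ℕ) {A : Set Ω} (hA : MeasurableSet[ℱ t] A) :
    μ.real (A ∩ {ω | proposer t ω ∉ H t ω}) ≤ (1 - (h₀ : ℝ) / n) * μ.real A := by
  classical
  have hAm : MeasurableSet A := ℱ.le t A hA
  have hHm : ∀ v, MeasurableSet {ω | v ∈ H t ω} := fun v => ℱ.le t _ (hH t v)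
  have hpm : ∀ v, MeasurableSet {ω | proposer t ω = v} :=
    fun v => ℱ.le (t + 1) _ (hf.revealed t v)
  have hn' : (0 : ℝ) < n := by exact_mod_cast hn
  -- Membership of `v` in `H t` is decided before the election, so fairness applies to the
  -- restricted event.
  have hone : ∀ v, μ.real ((A ∩ {ω | v ∈ H t ω}) ∩ {ω | proposer t ω = v}) =
      μ.real (A ∩ {ω | v ∈ H t ω}) / n := by
    intro v
    rw [measureReal_def, hf.fair t v _ (hA.inter (hH t v)), ENNReal.toReal_div,
      ENNReal.toReal_natCast, measureReal_def]
  have hsum : μ.real (A ∩ {ω | proposer t ω ∈ H t ω}) =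
      ∑ v : Fin n, μ.real (A ∩ {ω | v ∈ H t ω}) / n := by
    have hU : A ∩ {ω | proposer t ω ∈ H t ω} =
        ⋃ v : Fin n, (A ∩ {ω | v ∈ H t ω}) ∩ {ω | proposer t ω = v} := by
      ext ω
      simp only [Set.mem_inter_iff, Set.mem_ofPred_eq, Set.mem_iUnion]
      constructor
      · rintro ⟨h₁, h₂⟩
        exact ⟨proposer t ω, ⟨h₁, h₂⟩, rfl⟩
      · rintro ⟨v, ⟨h₁, h₂⟩, rfl⟩
        exact ⟨h₁, h₂⟩
    rw [hU, measureReal_iUnion_fintype]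
    · exact Finset.sum_congr rfl fun v _ => hone v
    · intro v w hvw
      refine Set.disjoint_left.2 fun ω h₁ h₂ => hvw ?_
      exact h₁.2.symm.trans h₂.2
    · exact fun v => (hAm.inter (hHm v)).inter (hpm v)
  -- The sum over `v` is the integral over `A` of the number of elements of `H t`.
  have hcount : (h₀ : ℝ) * μ.real A ≤ ∑ v : Fin n, μ.real (A ∩ {ω | v ∈ H t ω}) := by
    have h₁ : ∀ v, μ.real (A ∩ {ω | v ∈ H t ω}) =
        ∫ ω in A, Set.indicator {ω | v ∈ H t ω} (fun _ => (1 : ℝ)) ω ∂μ := by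
      intro v
      rw [integral_indicator_const _ (hHm v), smul_eq_mul, mul_one, measureReal_restrict_apply (hHm v),
        Set.inter_comm]
    have hint : ∀ v ∈ (Finset.univ : Finset (Fin n)), Integrable
        (fun ω => Set.indicator {ω | v ∈ H t ω} (fun _ => (1 : ℝ)) ω) (μ.restrict A) :=
      fun v _ => (integrable_const (1 : ℝ)).indicator (hHm v)
    simp only [h₁]
    rw [← integral_finsetSum _ hint]
    have hc : (h₀ : ℝ) * μ.real A = ∫ _ in A, (h₀ : ℝ) ∂μ := by
      rw [setIntegral_const, smul_eq_mul, mul_comm]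
    rw [hc]
    refine integral_mono (integrable_const _) (integrable_finsetSum _ hint) fun ω => ?_
    have h₂ : ∑ v : Fin n, Set.indicator {ω | v ∈ H t ω} (fun _ => (1 : ℝ)) ω =
        ((H t ω).ncard : ℝ) := by
      rw [Set.ncard_eq_toFinset_card']
      simp [Set.indicator_apply, Finset.sum_boole]
    simp only [h₂]
    exact_mod_cast hh t ω
  have hsplit : μ.real (A ∩ {ω | proposer t ω ∈ H t ω}) +
      μ.real (A ∩ {ω | proposer t ω ∉ H t ω}) = μ.real A := by
    have hm : MeasurableSet {ω | proposer t ω ∈ H t ω} := by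
      have : {ω | proposer t ω ∈ H t ω} =
          ⋃ v : Fin n, {ω | v ∈ H t ω} ∩ {ω | proposer t ω = v} := by
        ext ω
        simp
      rw [this]
      exact MeasurableSet.iUnion fun v => (hHm v).inter (hpm v)
    exact measureReal_inter_add_sdiff hm
  rw [← Finset.sum_div] at hsum
  have h₃ := div_le_div_of_nonneg_right hcount hn'.le
  rw [← hsum] at h₃
  have h₄ : (1 - (h₀ : ℝ) / n) * μ.real A = μ.real A - h₀ * μ.real A / n := by ring
  rw [h₄]
  linarith

open MeasureTheory in
/-- The proposers of `k` consecutive slots avoid the given sets with probability at most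
`(1 - h₀ / n) ^ k`. -/
theorem FairElection.measure_window_le {Ω : Type*} [mΩ : MeasurableSpace Ω] {n : ℕ}
    {μ : Measure Ω} [IsProbabilityMeasure μ] {ℱ : Filtration ℕ mΩ} {proposer : ℕ → Ω → Fin n}
    (hf : FairElection μ ℱ proposer) {H : ℕ → Ω → Set (Fin n)}
    (hH : ∀ t v, MeasurableSet[ℱ t] {ω | v ∈ H t ω}) {h₀ : ℕ} (hn : 0 < n)
    (hh : ∀ t ω, h₀ ≤ (H t ω).ncard) (hle : h₀ ≤ n) (s k : ℕ) :
    MeasurableSet[ℱ (s + k)] {ω | ∀ g, s ≤ g → g < s + k → proposer g ω ∉ H g ω} ∧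
      μ.real {ω | ∀ g, s ≤ g → g < s + k → proposer g ω ∉ H g ω} ≤ (1 - (h₀ : ℝ) / n) ^ k := by
  have hq : 0 ≤ 1 - (h₀ : ℝ) / n := by
    have hn' : (0 : ℝ) < n := by exact_mod_cast hn
    rw [sub_nonneg, div_le_one hn']
    exact_mod_cast hle
  induction k with
  | zero =>
    have : {ω | ∀ g, s ≤ g → g < s + 0 → proposer g ω ∉ H g ω} = Set.univ := by
      ext ω
      simp only [Set.mem_ofPred_eq, Set.mem_univ, iff_true]
      intro g h₁ h₂
      omega
    rw [this]
    exact ⟨MeasurableSet.univ, by simp⟩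
  | succ k ih =>
    obtain ⟨hm, hμ⟩ := ih
    have heq : {ω | ∀ g, s ≤ g → g < s + (k + 1) → proposer g ω ∉ H g ω} =
        {ω | ∀ g, s ≤ g → g < s + k → proposer g ω ∉ H g ω} ∩
          {ω | proposer (s + k) ω ∉ H (s + k) ω} := by
      ext ω
      simp only [Set.mem_inter_iff, Set.mem_ofPred_eq]
      constructor
      · exact fun h => ⟨fun g h₁ h₂ => h g h₁ (by omega), h (s + k) (by omega) (by omega)⟩
      · rintro ⟨h₁, h₂⟩ g hg hg'
        rcases Nat.lt_succ_iff_lt_or_eq.1 (show g < s + k + 1 by omega) with h' | rfl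
        · exact h₁ g hg h'
        · exact h₂
    rw [heq]
    constructor
    · have hle' : ℱ (s + k) ≤ ℱ (s + (k + 1)) := ℱ.mono (by omega)
      refine MeasurableSet.inter (hle' _ hm) ?_
      have : {ω | proposer (s + k) ω ∉ H (s + k) ω} =
          (⋃ v : Fin n, {ω | v ∈ H (s + k) ω} ∩ {ω | proposer (s + k) ω = v})ᶜ := by
        ext ω
        simp only [Set.mem_compl_iff, Set.mem_iUnion, Set.mem_inter_iff, Set.mem_ofPred_eq,
          not_exists, not_and]
        exact ⟨fun h v hv h' => h (h' ▸ hv), fun h hv => h _ hv rfl⟩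
      rw [this]
      exact (MeasurableSet.iUnion fun v => (hle' _ (hH _ v)).inter (hf.revealed _ v)).compl
    · refine (hf.measure_inter_avoid_le hH hn hh (s + k) hm).trans ?_
      rw [pow_succ, mul_comm]
      exact mul_le_mul_of_nonneg_right hμ hq

-- A failure by slot `T` exposes a window `[s, s + κ)` with `s + κ ≤ T` whose proposers all avoid
-- `H`. There are at most `T + 1 - κ ≤ T` such windows. The failure event is not assumed measurable;
-- monotonicity of `μ` suffices.
open MeasureTheory in
theorem measure_not_fastLive_le {Tx : Type*} {n Δ κ : ℕ} (hΔ : 0 < Δ) (hκ : 1 < κ) {Ω : Type*}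
    [mΩ : MeasurableSpace Ω] (μ : Measure Ω) [IsProbabilityMeasure μ] (ℱ : Filtration ℕ mΩ)
    (e : Ω → FRun n Δ Tx) (H : ℕ → Ω → Set (Fin n)) (h₀ T : ℕ)
    (he : ∀ ω, (e ω).Compliant ∧ Full.IsExecution (e ω) κ)
    (hf : FairElection μ ℱ (fun t ω => (e ω).proposer t))
    (hH : ∀ t v, MeasurableSet[ℱ t] {ω | v ∈ H t ω})
    (hled : ∀ t ω, ∀ v ∈ H t ω, v ∈ (e ω).active (proposing Δ t) ∧
      ∀ r < voting Δ t, v ∉ (e ω).corrupt r)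
    (hh : ∀ t ω, h₀ ≤ (H t ω).ncard) :
    μ.real {ω | ∃ t ≤ T, ¬ (e ω).FastLive (Full.available (e ω) κ) t} ≤
      T * (1 - (h₀ : ℝ) / n) ^ κ := by
  obtain ⟨ω₀⟩ : Nonempty Ω := nonempty_of_isProbabilityMeasure μ
  have hn : 0 < n := (he ω₀).1.n_pos
  have hle : h₀ ≤ n := by
    have := Set.ncard_le_card (H 0 ω₀)
    rw [Nat.card_eq_fintype_card, Fintype.card_fin] at this
    exact (hh 0 ω₀).trans this
  have hq : 0 ≤ 1 - (h₀ : ℝ) / n := by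
    have hn' : (0 : ℝ) < n := by exact_mod_cast hn
    rw [sub_nonneg, div_le_one hn']
    exact_mod_cast hle
  set W : ℕ → Set Ω := fun s => {ω | ∀ g, s ≤ g → g < s + κ → (e ω).proposer g ∉ H g ω} with hW
  have hsub : {ω | ∃ t ≤ T, ¬ (e ω).FastLive (Full.available (e ω) κ) t} ⊆
      ⋃ s ∈ Finset.range (T + 1 - κ), W s := by
    rintro ω ⟨t, htT, hnot⟩
    have hex : ¬ ∀ s, s + κ ≤ t → ∃ g, s ≤ g ∧ g < s + κ ∧ (e ω).HonestlyLed g :=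
      fun hall => hnot (Full.fastLive hΔ (he ω).1 (he ω).2 hall)
    push Not at hex
    obtain ⟨s, hst, hg⟩ := hex
    refine Set.mem_iUnion₂.2 ⟨s, Finset.mem_range.2 (by omega), fun g h₁ h₂ hmem => ?_⟩
    exact hg g h₁ h₂ (hled g ω _ hmem)
  calc μ.real {ω | ∃ t ≤ T, ¬ (e ω).FastLive (Full.available (e ω) κ) t}
      ≤ μ.real (⋃ s ∈ Finset.range (T + 1 - κ), W s) := measureReal_mono hsub (measure_ne_top _ _)
    _ ≤ ∑ s ∈ Finset.range (T + 1 - κ), μ.real (W s) := measureReal_biUnion_finset_le _ _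
    _ ≤ ∑ _s ∈ Finset.range (T + 1 - κ), (1 - (h₀ : ℝ) / n) ^ κ :=
        Finset.sum_le_sum fun s _ => (hf.measure_window_le hH hn hh hle s κ).2
    _ = ((T + 1 - κ : ℕ) : ℝ) * (1 - (h₀ : ℝ) / n) ^ κ := by simp
    _ ≤ T * (1 - (h₀ : ℝ) / n) ^ κ := by
        refine mul_le_mul_of_nonneg_right ?_ (pow_nonneg hq κ)
        exact_mod_cast (show T + 1 - κ ≤ T by omega)

theorem mainTheorem9 {Tx : Type*} (n Δ κ : ℕ) (hΔ : 0 < Δ) (hκ : 1 < κ) :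
    -- the dynamically available protocol, in every compliant execution
    (∀ e : Run n Δ Tx Unit Unit, e.Compliant → Ava.IsExecution e κ →
      ∀ t, e.FastLive (Ava.confirmed e κ) t) ∧
    -- the full protocol, if each `κ` consecutive slots up to `t` have one that is honestly led
    (∀ e : FRun n Δ Tx, e.Compliant → Full.IsExecution e κ →
      ∀ t, (∀ s, s + κ ≤ t → ∃ g, s ≤ g ∧ g < s + κ ∧ e.HonestlyLed g) →
        e.FastLive (Full.available e κ) t) ∧
    -- the full protocol with random proposers: all slots up to `T`, with overwhelming probability
    (∀ {Ω : Type*} [mΩ : MeasurableSpace Ω] (μ : MeasureTheory.Measure Ω)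
      [MeasureTheory.IsProbabilityMeasure μ] (ℱ : MeasureTheory.Filtration ℕ mΩ)
      (e : Ω → FRun n Δ Tx) (H : ℕ → Ω → Set (Fin n)) (h₀ T : ℕ),
      (∀ ω, (e ω).Compliant ∧ Full.IsExecution (e ω) κ) →
      FairElection μ ℱ (fun t ω => (e ω).proposer t) →
      (∀ t v, @MeasurableSet Ω (ℱ t) {ω | v ∈ H t ω}) →
      (∀ t ω, ∀ v ∈ H t ω, v ∈ (e ω).active (proposing Δ t) ∧
        ∀ r < voting Δ t, v ∉ (e ω).corrupt r) →
      (∀ t ω, h₀ ≤ (H t ω).ncard) →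
      μ.real {ω | ∃ t ≤ T, ¬ (e ω).FastLive (Full.available (e ω) κ) t} ≤
        T * (1 - (h₀ : ℝ) / n) ^ κ) := by
  refine ⟨fun e hc h t => Ava.fastLive hΔ hc h t, fun e hc h t hW => Full.fastLive hΔ hc h hW, ?_⟩
  intro Ω mΩ μ _ ℱ e H h₀ T he hf hH hled hh
  exact measure_not_fastLive_le hΔ hκ μ ℱ e H h₀ T he hf hH hled hh
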